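/- Let $\mathsf G=(\mathsf G_1\rightrightarrows \mathsf G_0)$ be an orbifold groupoid, i.e. a proper étale smooth groupoid ($s,t$ local diffeomorphisms, $(s,t):\mathsf G_1\to\mathsf G_0\times\mathsf G_0$ proper), where $ab$ is defined when $t(a)=s(b)$. Let $(\mathcal L,\theta)$ be a gerbe over $\mathsf G$: a smooth complex line bundle $\mathcal L\to \mathsf G_1$ together with isomorphisms $\theta_{a,b}:\mathcal L_a\otimes\mathcal L_b\cong\mathcal L_{ab}$, smooth in the composable pair $(a,b)$, which satisfy the cocycle (associativity) condition on composable triples. (If $\mathcal L$ is trivial, $\theta$ is a function with $\theta(a,b)\theta(ab,c)=\theta(a,bc)\theta(b,c)$.) The inertia groupoid $\wedge\mathsf G$ has objects $\wedge\mathsf G_0=\{a\in\mathsf G_1: s(a)=t(a)\}$, and its arrows $v:a\to b$ are the $v\in\mathsf G_1$ with $av=vb$. For such $v$ let $\rho(a,v):\mathcal L_a\to\mathcal L_b$ be the isomorphism with $\theta_{a,v}(u\otimes w)=\theta_{v,b}(w\otimes\rho(a,v)u)$ for all $u\in\mathcal L_a$, $w\in\mathcal L_v$ (for trivial $\mathcal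 L$: $\rho(a,v)=\theta(a,v)/\theta(v,v^{-1}av)$). Let the twisted sectors $\widetilde{\Sigma_1\mathsf G}$ be presented as the full subgroupoid of $\wedge\mathsf G$ on an open set $S\subset\wedge\mathsf G_0$ that meets every isomorphism class of objects of $\wedge\mathsf G$ (in an orbifold chart $(V,K)$ one chooses one $g$ in each conjugacy class of $K$ and obtains $\bigsqcup_{(g)}V^g\rtimes C(g)$). Then the line bundle obtained from $\mathcal L|_{S}$ with the gluing maps $\rho$ is an inner local system over $\widetilde{\Sigma_1\mathsf G}$. That is: the maps $\rho$ are functorial, so that they define a complex line orbibundle over $\widetilde{\Sigma_1\mathsf G}$, and this orbibundle carries a flat structure (local frames of $\mathcal L|_S$, each locally the restriction of a smooth section of $\mathcal L$, that differ by locally constant factors and with respect to which $\rho$ is locally constant) such that, writing $L_{(g)}$ for its restriction to the sector $X_{(g)}$, there are isomorphisms of flat line orbibundles 1. $L_{(1)}\cong 1$ over the nontwisted sector; 2. $I^*L_{(g^{-1})}\cong L_{(g)}^{-1}$, where $I:X_{(g)}\to X_{(g^{-1})}$ is induced by $g\mapsto g^{-1}$; 3. $e_1^*L_{(g_1)}\otimes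 e_2^*L_{(g_2)}\otimes e_3^*L_{(g_3)}\cong 1$ over the triple sectors $X_{(g_1,g_2,g_3)}$ with $g_1g_2g_3=1$, where $e_i$ is induced by $(g_1,g_2,g_3)\mapsto g_i$. -/

import Mathlib

open scoped Manifold ContDiff Topology
open Bundle

/-- A map defined on a subset `A` of a manifold `M` is smooth if near every point of `A` it is the
restriction of a smooth map defined on an open subset of `M`.  For an embedded submanifold `A` this
is smoothness in the intrinsic sense. -/
def SmoothOnSubset {E H M E' H' N : Type*}
    [NormedAddCommGroup E] [NormedSpace ℝ E] [TopologicalSpace H]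
    [TopologicalSpace M] [ChartedSpace H M]
    [NormedAddCommGroup E'] [NormedSpace ℝ E'] [TopologicalSpace H']
    [TopologicalSpace N] [ChartedSpace H' N]
    (I : ModelWithCorners ℝ E H) (J : ModelWithCorners ℝ E' H') (A : Set M) (f : A → N) : Prop :=
  ∀ p : A, ∃ U : Set M, IsOpen U ∧ p.1 ∈ U ∧
    ∃ F : M → N, ContMDiffOn I J ∞ F U ∧ ∀ q : A, q.1 ∈ U → F q.1 = f q

/-- A proper étale smooth groupoid with manifold of objects `G₀` and manifold of arrows `G₁`, both
without boundary and modelled on `E`.  The product `mul a b` is defined when the target of `a` is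
the source of `b` (first `a`, then `b`). -/
structure OrbifoldGroupoid (E G₀ G₁ : Type*)
    [NormedAddCommGroup E] [NormedSpace ℝ E]
    [TopologicalSpace G₀] [ChartedSpace E G₀] [TopologicalSpace G₁] [ChartedSpace E G₁] where
  s : G₁ → G₀
  t : G₁ → G₀
  e : G₀ → G₁
  inv : G₁ → G₁
  mul : ∀ a b : G₁, t a = s b → G₁
  s_e : ∀ x, s (e x) = x
  t_e : ∀ x, t (e x) = x
  s_inv : ∀ a, s (inv a) = t a
  t_inv : ∀ a, t (inv a) = s a
  s_mul : ∀ a b h, s (mul a b h) = s a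
  t_mul : ∀ a b h, t (mul a b h) = t b
  mul_assoc : ∀ a b c (hab : t a = s b) (hbc : t b = s c),
    mul (mul a b hab) c ((t_mul a b hab).trans hbc) =
      mul a (mul b c hbc) (hab.trans (s_mul b c hbc).symm)
  e_mul : ∀ a, mul (e (s a)) a (t_e (s a)) = a
  mul_e : ∀ a, mul a (e (t a)) (s_e (t a)).symm = a
  mul_inv : ∀ a, mul a (inv a) (s_inv a).symm = e (s a)
  inv_mul : ∀ a, mul (inv a) a (t_inv a) = e (t a)
  /-- étale -/
  s_etale : IsLocalDiffeomorph 𝓘(ℝ, E) 𝓘(ℝ, E) ∞ s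
  t_etale : IsLocalDiffeomorph 𝓘(ℝ, E) 𝓘(ℝ, E) ∞ t
  e_smooth : ContMDiff 𝓘(ℝ, E) 𝓘(ℝ, E) ∞ e
  inv_smooth : ContMDiff 𝓘(ℝ, E) 𝓘(ℝ, E) ∞ inv
  mul_smooth : SmoothOnSubset (𝓘(ℝ, E).prod 𝓘(ℝ, E)) 𝓘(ℝ, E)
    {p : G₁ × G₁ | t p.1 = s p.2} (fun p => mul p.1.1 p.1.2 p.2)
  /-- proper -/
  proper : IsProperMap (fun a : G₁ => (s a, t a))

namespace OrbifoldGroupoid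

variable {E G₀ G₁ : Type*} [NormedAddCommGroup E] [NormedSpace ℝ E]
  [TopologicalSpace G₀] [ChartedSpace E G₀] [TopologicalSpace G₁] [ChartedSpace E G₁]

/-- The objects of the inertia groupoid `∧G`: arrows of `G` with equal source and target, with the
subspace topology. -/
abbrev Loop (G : OrbifoldGroupoid E G₀ G₁) : Type _ := {a : G₁ // G.s a = G.t a}

/-- `v` is an arrow of the inertia groupoid from `a` to `b`, that is, `a v = v b`. -/
def IsInertiaArrow (G : OrbifoldGroupoid E G₀ G₁) (a : G.Loop) (v : G₁) (b : G.Loop) : Prop :=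
  ∃ (h : G.t a.1 = G.s v) (h' : G.t v = G.s b.1), G.mul a.1 v h = G.mul v b.1 h'

theorem isInertiaArrow_id (G : OrbifoldGroupoid E G₀ G₁) (a : G.Loop) :
    G.IsInertiaArrow a (G.e (G.s a.1)) a := by
  refine ⟨a.2.symm.trans (G.s_e _).symm, G.t_e _, ?_⟩
  rw [G.e_mul]
  have key : ∀ (y : G₀) (h : G.t a.1 = G.s (G.e y)), y = G.t a.1 →
      G.mul a.1 (G.e y) h = a.1 := by
    rintro y h rfl
    exact G.mul_e _
  exact key _ _ a.2

theorem IsInertiaArrow.comp {G : OrbifoldGroupoid E G₀ G₁} {a b c : G.Loop} {v w : G₁}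
    (hv : G.IsInertiaArrow a v b) (hw : G.IsInertiaArrow b w c) (h : G.t v = G.s w) :
    G.IsInertiaArrow a (G.mul v w h) c := by
  obtain ⟨h1, h2, h3⟩ := hv
  obtain ⟨k1, k2, k3⟩ := hw
  refine ⟨h1.trans (G.s_mul _ _ _).symm, (G.t_mul _ _ _).trans k2, ?_⟩
  rw [← G.mul_assoc a.1 v w h1 h, G.mul_assoc v w c.1 h k2]
  have e1 : ∀ (x y : G₁) (hx : G.t x = G.s w) (hy : G.t y = G.s w), x = y →
      G.mul x w hx = G.mul y w hy := by
    rintro x y hx hy rfl; rfl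
  have e2 : ∀ (x y : G₁) (hx : G.t v = G.s x) (hy : G.t v = G.s y), x = y →
      G.mul v x hx = G.mul v y hy := by
    rintro x y hx hy rfl; rfl
  rw [e1 _ _ _ ((G.t_mul v b.1 h2).trans k1) h3, G.mul_assoc v b.1 w h2 k1]
  exact e2 _ _ _ _ k3

/-- A set `S` of objects of `∧G` presents the twisted sectors as the full subgroupoid of `∧G` on
`S` when `S` is open and every object of `∧G` is isomorphic in `∧G` to one in `S`; the inclusion is
then a Morita equivalence.  In an orbifold chart `(V, K)`, where the objects of `∧G` are the
`⊔_{g ∈ K} V^g × {g}`, choosing one `g` in each conjugacy class of `K` gives the usual sectors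
`⊔_{(g)} V^g ⋊ C(g)`.  The choice `S = univ` is allowed as well. -/
structure IsTwistedSectors (G : OrbifoldGroupoid E G₀ G₁) (S : Set G.Loop) : Prop where
  isOpen : IsOpen S
  meets_orbits : ∀ a : G.Loop, ∃ b ∈ S, ∃ v, G.IsInertiaArrow a v b

/-- The space of arrows of the full subgroupoid of `∧G` on `S`: triples `(a, v, b)` with
`a, b ∈ S` and `v : a ⟶ b`. -/
abbrev SectorArrow (G : OrbifoldGroupoid E G₀ G₁) (S : Set G.Loop) : Type _ :=
  {p : S × G₁ × S // G.IsInertiaArrow p.1.1 p.2.1 p.2.2.1}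

/-- `g₁, …, gₙ` are loops at one common point and `g₁ ⋯ gₙ = 1`; the `p i` are the partial
products. -/
def HasUnitProduct (G : OrbifoldGroupoid E G₀ G₁) {n : ℕ} (g : Fin n → G.Loop) : Prop :=
  ∃ (x : G₀) (p : Fin (n + 1) → G₁), p 0 = G.e x ∧ p (Fin.last n) = G.e x ∧
    ∀ i : Fin n, ∃ h : G.t (p i.castSucc) = G.s (g i).1,
      p i.succ = G.mul (p i.castSucc) (g i).1 h

/-- Objects of the multisector of `n`-tuples `(g₁, …, gₙ)` with `g₁ ⋯ gₙ = 1`, presented so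
that the `n` evaluation maps `eᵢ : (g₁, …, gₙ) ↦ gᵢ` become maps to the groupoid on `S`: besides
the tuple `g` an object records arrows `vᵢ : gᵢ ⟶ bᵢ` of `∧G` with `bᵢ ∈ S`, and `eᵢ` sends it to
`bᵢ`.  (It is the fibre product, in the sense of groupoids, of the multisector and `Sⁿ` over
`(∧G)ⁿ`, so it is Morita equivalent to the multisector.) -/
abbrev MultiSector (G : OrbifoldGroupoid E G₀ G₁) (S : Set G.Loop) (n : ℕ) : Type _ :=
  {q : (Fin n → G.Loop) × (Fin n → G₁) × (Fin n → S) //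
    G.HasUnitProduct q.1 ∧ ∀ i, G.IsInertiaArrow (q.1 i) (q.2.1 i) (q.2.2 i).1}

/-- Arrows between objects `q = (g, v, b)` and `q' = (g', v', b')` of the multisector: an arrow `z`
of `G` that conjugates every `gᵢ` to `g'ᵢ`, and arrows `yᵢ : bᵢ ⟶ b'ᵢ` with `vᵢ yᵢ = z v'ᵢ`.  The
evaluation map `eᵢ` sends it to `yᵢ`. -/
def IsMultiSectorArrow (G : OrbifoldGroupoid E G₀ G₁) {S : Set G.Loop} {n : ℕ}
    (q q' : G.MultiSector S n) (z : G₁) (y : Fin n → G₁) : Prop :=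
  ∀ i, G.IsInertiaArrow (q.1.1 i) z (q'.1.1 i) ∧
    G.IsInertiaArrow (q.1.2.2 i).1 (y i) (q'.1.2.2 i).1 ∧
    ∃ (h : G.t (q.1.2.1 i) = G.s (y i)) (h' : G.t z = G.s (q'.1.2.1 i)),
      G.mul (q.1.2.1 i) (y i) h = G.mul z (q'.1.2.1 i) h'

/-- A flat complex line orbibundle over the full subgroupoid of `∧G` on `S`, with fibres `F a`: the
arrows act functorially and linearly, and the flat structure is an atlas of nowhere vanishing local
frames (the flat ones) which differ by locally constant factors and with respect to which the arrows
act by locally constant factors. -/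
structure FlatLineOrbibundle (G : OrbifoldGroupoid E G₀ G₁) (S : Set G.Loop)
    (F : S → Type*) [∀ a, AddCommGroup (F a)] [∀ a, Module ℂ (F a)] where
  finrank_eq_one : ∀ a, Module.finrank ℂ (F a) = 1
  act : ∀ (a b : S) (v : G₁), G.IsInertiaArrow a.1 v b.1 → (F a →ₗ[ℂ] F b)
  act_id : ∀ (a : S) (u : F a), act a a (G.e (G.s a.1.1)) (G.isInertiaArrow_id a.1) u = u
  act_comp : ∀ (a b c : S) (v w : G₁) (hv : G.IsInertiaArrow a.1 v b.1)
    (hw : G.IsInertiaArrow b.1 w c.1) (h : G.t v = G.s w) (u : F a),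
    act a c (G.mul v w h) (hv.comp hw h) u = act b c w hw (act a b v hv u)
  /-- `IsFrame U σ`: the values of `σ` on `U` form a flat frame; values outside `U` are
  irrelevant. -/
  IsFrame : Set S → (∀ a, F a) → Prop
  isOpen_of_isFrame : ∀ U σ, IsFrame U σ → IsOpen U
  frame_ne_zero : ∀ U σ, IsFrame U σ → ∀ a ∈ U, σ a ≠ 0
  exists_frame : ∀ a, ∃ U σ, IsFrame U σ ∧ a ∈ U
  frame_compat : ∀ U σ V τ, IsFrame U σ → IsFrame V τ → ∀ a ∈ U ∩ V, ∀ c : ℂ,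
    τ a = c • σ a → ∀ᶠ b in 𝓝 a, τ b = c • σ b
  act_flat : ∀ U σ V τ, IsFrame U σ → IsFrame V τ → ∀ p : G.SectorArrow S,
    p.1.1 ∈ U → p.1.2.2 ∈ V → ∀ c : ℂ,
    act p.1.1 p.1.2.2 p.1.2.1 p.2 (σ p.1.1) = c • τ p.1.2.2 →
    ∀ᶠ q : G.SectorArrow S in 𝓝 p,
      act q.1.1 q.1.2.2 q.1.2.1 q.2 (σ q.1.1) = c • τ q.1.2.2

/-- A flat trivialization of the line orbibundle `e₁^* F ⊗ ⋯ ⊗ eₙ^* F` over the multisector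
`g₁ ⋯ gₙ = 1`: fibrewise a nowhere vanishing `n`-linear form, invariant under the arrows of the
multisector and locally constant in flat frames. -/
structure FlatTrivialization {G : OrbifoldGroupoid E G₀ G₁} {S : Set G.Loop}
    {F : S → Type*} [∀ a, AddCommGroup (F a)] [∀ a, Module ℂ (F a)]
    (B : G.FlatLineOrbibundle S F) (n : ℕ) where
  form : ∀ q : G.MultiSector S n, MultilinearMap ℂ (fun i => F (q.1.2.2 i)) ℂ
  form_ne_zero : ∀ q u, (∀ i, u i ≠ 0) → form q u ≠ 0
  form_invariant : ∀ (q q' : G.MultiSector S n) (z : G₁) (y : Fin n → G₁)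
    (h : G.IsMultiSectorArrow q q' z y) (u : ∀ i, F (q.1.2.2 i)),
    form q' (fun i => B.act (q.1.2.2 i) (q'.1.2.2 i) (y i) (h i).2.1 (u i)) = form q u
  form_flat : ∀ (U : Fin n → Set S) (σ : Fin n → ∀ a, F a), (∀ i, B.IsFrame (U i) (σ i)) →
    ∀ q : G.MultiSector S n, (∀ i, q.1.2.2 i ∈ U i) →
    ∀ᶠ r : G.MultiSector S n in 𝓝 q,
      form r (fun i => σ i (r.1.2.2 i)) = form q (fun i => σ i (q.1.2.2 i))

/-- An inner local system over the twisted sectors presented by `S`, with fibres `F`: a flat complex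
line orbibundle such that, as flat line orbibundles,
* its restriction to the nontwisted sector `g = 1` is trivial;
* `L_(g) ⊗ I^* L_(g⁻¹)` is trivial, `I : X_(g) → X_(g⁻¹)` being the inversion `g ↦ g⁻¹`
  (pairs with `g₁ g₂ = 1` are pairs `(g, g⁻¹)`);
* `e₁^* L_(g₁) ⊗ e₂^* L_(g₂) ⊗ e₃^* L_(g₃)` is trivial over the triple sectors with
  `g₁ g₂ g₃ = 1`. -/
structure InnerLocalSystem (G : OrbifoldGroupoid E G₀ G₁) (S : Set G.Loop)
    (F : S → Type*) [∀ a, AddCommGroup (F a)] [∀ a, Module ℂ (F a)]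
    extends G.FlatLineOrbibundle S F where
  nontwisted : FlatTrivialization toFlatLineOrbibundle 1
  inversion : FlatTrivialization toFlatLineOrbibundle 2
  triple : FlatTrivialization toFlatLineOrbibundle 3

/-- A gerbe over `G` whose line bundle over `G₁` is `L`: isomorphisms
`θ_{a,b} : L_a ⊗ L_b ≅ L_{ab}` depending smoothly on the composable pair `(a, b)` and satisfying the
cocycle condition, that is, associativity over composable triples.  For the trivial bundle `L`, `θ`
is a smooth function with `θ(a,b) θ(ab,c) = θ(a,bc) θ(b,c)`. -/
structure Gerbe (G : OrbifoldGroupoid E G₀ G₁) (L : G₁ → Type*)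
    [∀ a, AddCommGroup (L a)] [∀ a, Module ℂ (L a)] [∀ a, TopologicalSpace (L a)]
    [TopologicalSpace (TotalSpace ℂ L)] [FiberBundle ℂ L] where
  θ : ∀ (a b : G₁) (h : G.t a = G.s b), L a →ₗ[ℂ] L b →ₗ[ℂ] L (G.mul a b h)
  θ_ne_zero : ∀ a b h (u : L a) (w : L b), u ≠ 0 → w ≠ 0 → θ a b h u w ≠ 0
  cocycle : ∀ a b c (hab : G.t a = G.s b) (hbc : G.t b = G.s c) (u : L a) (v : L b) (w : L c),
    (TotalSpace.mk' ℂ _ (θ (G.mul a b hab) c ((G.t_mul a b hab).trans hbc) (θ a b hab u v) w) :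
        TotalSpace ℂ L) =
      TotalSpace.mk' ℂ _ (θ a (G.mul b c hbc) (hab.trans (G.s_mul b c hbc).symm) u (θ b c hbc v w))
  smooth : SmoothOnSubset
    ((𝓘(ℝ, E).prod 𝓘(ℝ, ℂ)).prod (𝓘(ℝ, E).prod 𝓘(ℝ, ℂ))) (𝓘(ℝ, E).prod 𝓘(ℝ, ℂ))
    {p : TotalSpace ℂ L × TotalSpace ℂ L | G.t p.1.proj = G.s p.2.proj}
    (fun p => TotalSpace.mk' ℂ _ (θ p.1.1.proj p.1.2.proj p.2 p.1.1.snd p.1.2.snd))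

namespace Gerbe

variable {G : OrbifoldGroupoid E G₀ G₁} {L : G₁ → Type*}
  [∀ a, AddCommGroup (L a)] [∀ a, Module ℂ (L a)] [∀ a, TopologicalSpace (L a)]
  [TopologicalSpace (TotalSpace ℂ L)] [FiberBundle ℂ L]

theorem exists_rho [VectorBundle ℂ ℂ L] (g : G.Gerbe L) (a b : G.Loop) (v : G₁)
    (hv : G.IsInertiaArrow a v b) :
    ∃! r : L a.1 →ₗ[ℂ] L b.1, ∀ (u : L a.1) (w : L v),
      (TotalSpace.mk' ℂ _ (g.θ a.1 v hv.choose u w) : TotalSpace ℂ L) =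
        TotalSpace.mk' ℂ _ (g.θ v b.1 hv.choose_spec.choose w (r u)) := by
  have fr : ∀ x : G₁, Module.finrank ℂ (L x) = 1 := fun x => by
    rw [((trivializationAt ℂ L x).linearEquivAt ℂ x
      (mem_baseSet_trivializationAt ℂ L x)).finrank_eq]
    exact Module.finrank_self ℂ
  have fd : ∀ x : G₁, FiniteDimensional ℂ (L x) := fun x =>
    FiniteDimensional.of_finrank_eq_succ (fr x)
  generalize hv.choose_spec.choose = h2
  have h3 : G.mul a.1 v hv.choose = G.mul v b.1 h2 := hv.choose_spec.choose_spec
  generalize hv.choose = h1 at h3 ⊢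
  obtain ⟨w₀, hw₀, hspan⟩ := finrank_eq_one_iff'.1 (fr v)
  have cast : ∀ x y : G₁, x = y → ∃ c : L x →ₗ[ℂ] L y, ∀ z,
      (TotalSpace.mk' ℂ y (c z) : TotalSpace ℂ L) = TotalSpace.mk' ℂ x z := by
    rintro x y rfl
    exact ⟨LinearMap.id, fun z => rfl⟩
  obtain ⟨c, hc⟩ := cast _ _ h3
  have inj : Function.Injective (g.θ v b.1 h2 w₀) := by
    rw [injective_iff_map_eq_zero]
    intro u hu
    by_contra hne
    exact g.θ_ne_zero _ _ _ _ _ hw₀ hne hu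
  let f := LinearEquiv.ofInjectiveOfFinrankEq (g.θ v b.1 h2 w₀) inj (by rw [fr, fr])
  have hf : ∀ z, g.θ v b.1 h2 w₀ (f.symm z) = z := fun z => f.apply_symm_apply z
  refine ⟨f.symm.toLinearMap ∘ₗ c ∘ₗ (g.θ a.1 v h1).flip w₀, ?_, ?_⟩
  · intro u w
    obtain ⟨k, rfl⟩ := hspan w
    rw [← hc]
    congr 1
    simp [hf]
  · intro r hr
    ext u
    apply inj
    have := hr u w₀
    rw [← hc] at this
    have h5 := (TotalSpace.mk_inj).1 this
    simp [hf, h5]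

/-- The gluing map `ρ(a, v) : L_a → L_b` over an arrow `v : a ⟶ b` of the inertia groupoid, obtained
from `L_a ⊗ L_v ≅ L_{av} = L_{vb} ≅ L_v ⊗ L_b`: it is characterized by
`θ_{a,v}(u ⊗ w) = θ_{v,b}(w ⊗ ρ(a, v) u)`.  For trivial `L` this is multiplication by
`θ(a, v) / θ(v, v⁻¹ a v)`. -/
noncomputable def rho [VectorBundle ℂ ℂ L] (g : G.Gerbe L) (a b : G.Loop) (v : G₁)
    (hv : G.IsInertiaArrow a v b) : L a.1 →ₗ[ℂ] L b.1 :=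
  (g.exists_rho a b v hv).choose

end Gerbe

end OrbifoldGroupoid

/-! The nonzero vectors of `L` are the arrows of a groupoid, a central extension of `G` by `ℂˣ`:
associativity is the cocycle condition, and units and inverses come from rescaling. A vector over a
loop at `x` is an element of the isotropy group `Hom x x`, and `ρ(a, v)` is conjugation by any lift
of `v` (`ofLoop_rho`), so functoriality is immediate.

Flatness comes from torsion. Properness makes the isotropy groups of `G` finite, of locally bounded
order, so each `Hom x x` is a central extension of a finite group by `ℂˣ`. A frame counts as flat if
it is locally smooth and its values locally satisfy `u ^ n = 1` for a fixed `n > 0`. Two such frames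
differ by a continuous function whose values are roots of unity of bounded order, hence by a locally
constant one (`eventually_eq_smul_of_isTorsion`). Conjugation preserves orders, so `ρ` is flat. Such
frames exist (`exists_torsion_section`): if the loop `a` has order dividing `n`, a smooth frame `W`
satisfies `W ^ n = c • 1` over nearby loops, because the units are open, and it remains to divide
`W` by a smooth `n`-th root of `c`.

The three trivializations are one construction. When `g₁ ⋯ gₙ = 1`, the product of vectors over the
`gᵢ` lies over a unit and is a scalar multiple of `1`; this scalar is the `n`-linear form. It is
invariant because scalars are fixed by conjugation. It is flat because a product of elements of
bounded order again has bounded order: in a group whose centre has finite index `k`, the transfer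
shows that `u ↦ u ^ k` is a homomorphism into the centre (`partialProd_pow_eq_one`). -/

namespace OrbifoldGroupoid

namespace Gerbe

/-! ### The central extension of `G` by `ℂˣ` -/

section Algebra

variable {E G₀ G₁ : Type*} [NormedAddCommGroup E] [NormedSpace ℝ E]
  [TopologicalSpace G₀] [ChartedSpace E G₀] [TopologicalSpace G₁] [ChartedSpace E G₁]
  {G : OrbifoldGroupoid E G₀ G₁} {L : G₁ → Type*}
  [∀ a, AddCommGroup (L a)] [∀ a, Module ℂ (L a)] [∀ a, TopologicalSpace (L a)]
  [TopologicalSpace (TotalSpace ℂ L)] [FiberBundle ℂ L]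

/-- The product of two composable vectors of a gerbe. -/
def prod (g : G.Gerbe L) (p q : TotalSpace ℂ L) (h : G.t p.1 = G.s q.1) : TotalSpace ℂ L :=
  ⟨G.mul p.1 q.1 h, g.θ p.1 q.1 h p.2 q.2⟩

/-- Nonzero vectors of the line bundle over arrows from `x` to `y`: the arrows of the central
extension of the groupoid `G` defined by the gerbe. -/
def Hom (_ : G.Gerbe L) (x y : G₀) : Type _ :=
  {p : TotalSpace ℂ L // p.2 ≠ 0 ∧ G.s p.1 = x ∧ G.t p.1 = y}

variable {g : G.Gerbe L} {x y z : G₀}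

namespace Hom

theorem ext {p q : g.Hom x y} (h : p.1 = q.1) : p = q := Subtype.ext h

/-- Composition in the central extension. -/
def comp (p : g.Hom x y) (q : g.Hom y z) : g.Hom x z :=
  ⟨g.prod p.1 q.1 (p.2.2.2.trans q.2.2.1.symm),
    g.θ_ne_zero _ _ _ _ _ p.2.1 q.2.1, (G.s_mul _ _ _).trans p.2.2.1,
    (G.t_mul _ _ _).trans q.2.2.2⟩

theorem comp_assoc {x y z w : G₀} (p : g.Hom x y) (q : g.Hom y z) (r : g.Hom z w) :
    (p.comp q).comp r = p.comp (q.comp r) :=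
  ext (g.cocycle _ _ _ _ _ _ _ _)

instance : MulAction ℂˣ (g.Hom x y) where
  smul c p := ⟨⟨p.1.1, (c : ℂ) • p.1.2⟩, smul_ne_zero c.ne_zero p.2.1, p.2.2⟩
  one_smul p := ext (by
    change (⟨p.1.1, ((1 : ℂˣ) : ℂ) • p.1.2⟩ : TotalSpace ℂ L) = p.1
    simp)
  mul_smul c d p := ext (by
    change (⟨p.1.1, ((c * d : ℂˣ) : ℂ) • p.1.2⟩ : TotalSpace ℂ L) =
      ⟨p.1.1, (c : ℂ) • (d : ℂ) • p.1.2⟩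
    simp [mul_smul])

theorem smul_arrow (c : ℂˣ) (p : g.Hom x y) : (c • p).1.1 = p.1.1 := rfl

/-- Together with `comp_smul`, bilinearity of `θ` makes scalars central in the extension. -/
theorem smul_comp (c : ℂˣ) (p : g.Hom x y) (q : g.Hom y z) :
    (c • p).comp q = c • p.comp q :=
  ext (by
    change (⟨_, g.θ _ _ _ ((c : ℂ) • p.1.2) q.1.2⟩ : TotalSpace ℂ L) = ⟨_, (c : ℂ) • _⟩
    rw [map_smul, LinearMap.smul_apply]; rfl)

theorem comp_smul (c : ℂˣ) (p : g.Hom x y) (q : g.Hom y z) :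
    p.comp (c • q) = c • p.comp q :=
  ext (by
    change (⟨_, g.θ _ _ _ p.1.2 ((c : ℂ) • q.1.2)⟩ : TotalSpace ℂ L) = ⟨_, (c : ℂ) • _⟩
    rw [map_smul]; rfl)

theorem smul_left_cancel {c d : ℂˣ} {p : g.Hom x y} (h : c • p = d • p) : c = d := by
  have h1 : (⟨p.1.1, (c : ℂ) • p.1.2⟩ : TotalSpace ℂ L) = ⟨p.1.1, (d : ℂ) • p.1.2⟩ :=
    congrArg Subtype.val h
  have h2 : (c : ℂ) • p.1.2 = (d : ℂ) • p.1.2 := (TotalSpace.mk_inj).1 h1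
  exact Units.ext (smul_left_injective ℂ p.2.1 h2)

/-- A nonzero vector over a loop as an automorphism in the central extension. -/
def ofLoop (g : G.Gerbe L) (a : G.Loop) (hx : G.s a.1 = x) {u : L a.1} (hu : u ≠ 0) :
    g.Hom x x :=
  ⟨⟨a.1, u⟩, hu, hx, a.2.symm.trans hx⟩

theorem ofLoop_smul (a : G.Loop) (hx : G.s a.1 = x) {u : L a.1} (hu : u ≠ 0) (c : ℂˣ)
    (hcu : (c : ℂ) • u ≠ 0) : ofLoop g a hx hcu = c • ofLoop g a hx hu := rfl

theorem ofLoop_inj {a : G.Loop} {hx : G.s a.1 = x} {u w : L a.1} {hu : u ≠ 0} {hw : w ≠ 0}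
    (h : ofLoop g a hx hu = ofLoop g a hx hw) : u = w :=
  TotalSpace.mk_inj.1 (congrArg Subtype.val h)

end Hom

variable [VectorBundle ℂ ℂ L]

variable (L) in
theorem finrank_fiber (a : G₁) : Module.finrank ℂ (L a) = 1 := by
  rw [((trivializationAt ℂ L a).linearEquivAt ℂ a
    (mem_baseSet_trivializationAt ℂ L a)).finrank_eq]
  exact Module.finrank_self ℂ

variable (L) in
theorem exists_fiber_ne_zero (a : G₁) : ∃ u : L a, u ≠ 0 :=
  (finrank_eq_one_iff'.1 (finrank_fiber L a)).imp fun _ h => h.1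

theorem exists_smul_eq_of_ne_zero {a : G₁} {u : L a} (hu : u ≠ 0) (w : L a) :
    ∃ c : ℂ, c • u = w :=
  (finrank_eq_one_iff_of_nonzero' u hu).1 (finrank_fiber L a) w

namespace Hom

theorem exists_smul_eq (p q : g.Hom x y) (h : p.1.1 = q.1.1) : ∃ c : ℂˣ, q = c • p := by
  obtain ⟨⟨a, u⟩, hu, hp⟩ := p
  obtain ⟨⟨b, w⟩, hw, hq⟩ := q
  obtain rfl : a = b := h
  obtain ⟨c, rfl⟩ := exists_smul_eq_of_ne_zero hu w
  have hc : c ≠ 0 := by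
    rintro rfl
    exact hw (zero_smul _ _)
  exact ⟨Units.mk0 c hc, rfl⟩

variable (g) in
/-- Every arrow lifts to the central extension. -/
theorem exists_lift (v : G₁) (hs : G.s v = x) (ht : G.t v = y) :
    ∃ w : g.Hom x y, w.1.1 = v := by
  obtain ⟨u, hu⟩ := exists_fiber_ne_zero L v
  exact ⟨⟨⟨v, u⟩, hu, hs, ht⟩, rfl⟩

theorem e_mul_of_eq {a : G₁} (h : G.s a = x) (h' : G.t (G.e x) = G.s a) :
    G.mul (G.e x) a h' = a := by
  subst h; exact G.e_mul a

theorem mul_e_of_eq {a : G₁} (h : G.t a = x) (h' : G.t a = G.s (G.e x)) :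
    G.mul a (G.e x) h' = a := by
  subst h; exact G.mul_e a

-- The line over a unit arrow is closed under the product, so `p · p = c • p`, and `c⁻¹ • p` is
-- idempotent. No unit is part of the data of a gerbe; this idempotent serves as one.
variable (g x) in
theorem exists_one : ∃ p : g.Hom x x, p.1.1 = G.e x ∧ p.comp p = p := by
  obtain ⟨p, hp⟩ := exists_lift g (G.e x) (G.s_e x) (G.t_e x)
  obtain ⟨c, hc⟩ := exists_smul_eq p (p.comp p) (by
    change _ = G.mul p.1.1 p.1.1 _
    simp only [hp]
    exact (e_mul_of_eq (G.s_e x) _).symm)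
  refine ⟨c⁻¹ • p, hp, ?_⟩
  rw [smul_comp, comp_smul, hc, inv_smul_smul]

variable (g x) in
/-- The unit of the central extension. -/
noncomputable def one : g.Hom x x := (exists_one g x).choose

theorem one_arrow : (one g x).1.1 = G.e x := (exists_one g x).choose_spec.1

theorem one_comp_one : (one g x).comp (one g x) = one g x := (exists_one g x).choose_spec.2

/-- Both sides lie over the same arrow, so `1 · p = c • p`; multiplying by the idempotent `1` once
more gives `c = c * c`, hence `c = 1`. -/
theorem one_comp (p : g.Hom x y) : (one g x).comp p = p := by
  obtain ⟨c, hc⟩ := exists_smul_eq p ((one g x).comp p) (by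
    change _ = G.mul (one g x).1.1 p.1.1 _
    simp only [one_arrow]
    exact (e_mul_of_eq p.2.2.1 _).symm)
  have h := comp_assoc (one g x) (one g x) p
  rw [one_comp_one, hc, comp_smul, hc, smul_smul] at h
  rw [hc, left_eq_mul.1 (smul_left_cancel h), one_smul]

theorem comp_one (p : g.Hom x y) : p.comp (one g y) = p := by
  obtain ⟨c, hc⟩ := exists_smul_eq p (p.comp (one g y)) (by
    change _ = G.mul p.1.1 (one g y).1.1 _
    simp only [one_arrow]
    exact (mul_e_of_eq p.2.2.2 _).symm)
  have h := comp_assoc p (one g y) (one g y)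
  rw [one_comp_one, hc, smul_comp, hc, smul_smul] at h
  rw [hc, mul_eq_left.1 (smul_left_cancel h), one_smul]

theorem exists_smul_one_eq (p : g.Hom x x) (h : p.1.1 = G.e x) : ∃ c : ℂˣ, p = c • one g x :=
  exists_smul_eq _ _ (one_arrow.trans h.symm)

theorem exists_comp_eq_one (p : g.Hom x y) : ∃ q : g.Hom y x, p.comp q = one g x := by
  obtain ⟨q, hq⟩ := exists_lift g (x := y) (y := x) (G.inv p.1.1)
    ((G.s_inv _).trans p.2.2.2) ((G.t_inv _).trans p.2.2.1)
  obtain ⟨c, hc⟩ := exists_smul_one_eq (p.comp q) (by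
    change G.mul p.1.1 q.1.1 _ = _
    simp only [hq]
    rw [G.mul_inv, p.2.2.1])
  exact ⟨c⁻¹ • q, by rw [comp_smul, hc, inv_smul_smul]⟩

/-- The inverse in the central extension. -/
noncomputable def inv (p : g.Hom x y) : g.Hom y x := (exists_comp_eq_one p).choose

theorem comp_inv (p : g.Hom x y) : p.comp p.inv = one g x := (exists_comp_eq_one p).choose_spec

theorem inv_comp (p : g.Hom x y) : p.inv.comp p = one g y := by
  calc p.inv.comp p = (p.inv.comp p).comp (p.inv.comp p.inv.inv) := by rw [comp_inv, comp_one]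
    _ = p.inv.comp ((p.comp p.inv).comp p.inv.inv) := by simp only [comp_assoc]
    _ = one g y := by rw [comp_inv, one_comp, comp_inv]

noncomputable instance : Group (g.Hom x x) where
  mul := comp
  mul_assoc := comp_assoc
  one := one g x
  one_mul := one_comp
  mul_one := comp_one
  inv := inv
  inv_mul_cancel := inv_comp

theorem mul_def (p q : g.Hom x x) : p * q = p.comp q := rfl

theorem one_def : (1 : g.Hom x x) = one g x := rfl

theorem one_val_arrow : (1 : g.Hom x x).1.1 = G.e x := one_arrow

instance : IsScalarTower ℂˣ (g.Hom x x) (g.Hom x x) := ⟨smul_comp⟩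

instance : SMulCommClass ℂˣ (g.Hom x x) (g.Hom x x) := ⟨fun c p q => (comp_smul c p q).symm⟩

/-- Conjugation `u ↦ w⁻¹ u w` by a morphism of the central extension. -/
noncomputable def conj (w : g.Hom x y) : g.Hom x x ≃* g.Hom y y where
  toFun u := w.inv.comp (u.comp w)
  invFun u := w.comp (u.comp w.inv)
  left_inv u := by
    dsimp only
    rw [comp_assoc, comp_assoc, comp_inv, comp_one, ← comp_assoc, comp_inv, one_comp]
  right_inv u := by
    dsimp only
    rw [comp_assoc, comp_assoc, inv_comp, comp_one, ← comp_assoc, inv_comp, one_comp]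
  map_mul' u v := by
    simp only [mul_def, comp_assoc]
    rw [← comp_assoc w w.inv, comp_inv, one_comp]

theorem conj_apply (w : g.Hom x y) (u : g.Hom x x) : conj w u = w.inv.comp (u.comp w) := rfl

theorem comp_conj (w : g.Hom x y) (u : g.Hom x x) : w.comp (conj w u) = u.comp w := by
  rw [conj_apply, ← comp_assoc, comp_inv, one_comp]

theorem eq_conj_iff {w : g.Hom x y} {u : g.Hom x x} {u' : g.Hom y y} :
    u' = conj w u ↔ w.comp u' = u.comp w := by
  constructor
  · rintro rfl
    exact comp_conj w u
  · intro h
    rw [conj_apply, ← h, ← comp_assoc, inv_comp, one_comp]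

theorem conj_comp (w : g.Hom x y) (w' : g.Hom y z) (u : g.Hom x x) :
    conj (w.comp w') u = conj w' (conj w u) := by
  symm
  rw [eq_conj_iff, comp_assoc, comp_conj, ← comp_assoc, comp_conj, comp_assoc]

theorem conj_one (u : g.Hom x x) : conj (one g x) u = u := by
  symm
  rw [eq_conj_iff, one_comp, comp_one]

/-- Two lifts of one arrow differ by a scalar, and scalars are central. Hence any lift of `v` may be
used to compute `ρ(a, v)`. -/
theorem conj_congr {w w' : g.Hom x y} (h : w.1.1 = w'.1.1) : conj w = conj w' := by
  obtain ⟨c, rfl⟩ := exists_smul_eq w w' h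
  ext1 u
  rw [eq_conj_iff, smul_comp, comp_conj, comp_smul]

theorem conj_smul (w : g.Hom x y) (c : ℂˣ) (u : g.Hom x x) :
    conj w (c • u) = c • conj w u := by
  symm
  rw [eq_conj_iff, comp_smul, comp_conj, smul_comp]

theorem conj_symm_smul (w : g.Hom x y) (c : ℂˣ) (u : g.Hom y y) :
    (conj w).symm (c • u) = c • (conj w).symm u := by
  rw [MulEquiv.symm_apply_eq, conj_smul, MulEquiv.apply_symm_apply]

end Hom

/-! ### The gluing maps as conjugations -/

theorem rho_spec (g : G.Gerbe L) {a b : G.Loop} {v : G₁} (hv : G.IsInertiaArrow a v b)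
    (u : L a.1) (w : L v) :
    (TotalSpace.mk' ℂ _ (g.θ a.1 v hv.choose u w) : TotalSpace ℂ L) =
      TotalSpace.mk' ℂ _ (g.θ v b.1 hv.choose_spec.choose w (g.rho a b v hv u)) :=
  (g.exists_rho a b v hv).choose_spec.1 u w

theorem rho_ne_zero (g : G.Gerbe L) {a b : G.Loop} {v : G₁} (hv : G.IsInertiaArrow a v b)
    {u : L a.1} (hu : u ≠ 0) : g.rho a b v hv u ≠ 0 := by
  obtain ⟨w, hw⟩ := exists_fiber_ne_zero L v
  intro h
  have h1 := g.rho_spec hv u w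
  rw [h, map_zero] at h1
  have h2 : ∀ (p q : TotalSpace ℂ L), p = q → q.2 = 0 → p.2 = 0 := by
    rintro p q rfl h; exact h
  exact g.θ_ne_zero _ _ _ _ _ hu hw (h2 _ _ h1 rfl)

-- The defining equation of `ρ` reads `w · ρ(u) = u · w` in the extension, that is, `ρ(u) = w⁻¹ u
-- w`.
open Hom in
theorem ofLoop_rho (g : G.Gerbe L) {a b : G.Loop} {v : G₁} (hv : G.IsInertiaArrow a v b)
    (hx : G.s a.1 = x) (hy : G.s b.1 = y) (w : g.Hom x y) (hw : w.1.1 = v) {u : L a.1}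
    (hu : u ≠ 0) :
    ofLoop g b hy (g.rho_ne_zero hv hu) = conj w (ofLoop g a hx hu) := by
  subst hw
  rw [eq_conj_iff]
  exact ext (g.rho_spec hv u w.1.2).symm

open Hom in
theorem eq_rho (g : G.Gerbe L) {a b : G.Loop} {v : G₁} (hv : G.IsInertiaArrow a v b)
    (hx : G.s a.1 = x) (hy : G.s b.1 = y) (w : g.Hom x y) (hw : w.1.1 = v) {u : L a.1}
    (hu : u ≠ 0) {u' : L b.1} (hu' : u' ≠ 0)
    (h : ofLoop g b hy hu' = conj w (ofLoop g a hx hu)) : g.rho a b v hv u = u' :=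
  ofLoop_inj ((g.ofLoop_rho hv hx hy w hw hu).trans h.symm)

open Hom in
theorem rho_id (g : G.Gerbe L) (a : G.Loop) (u : L a.1) :
    g.rho a a (G.e (G.s a.1)) (G.isInertiaArrow_id a) u = u := by
  by_cases hu : u = 0
  · rw [hu, map_zero]
  · exact g.eq_rho _ rfl rfl (one g _) one_arrow hu hu (conj_one _).symm

open Hom in
theorem rho_comp (g : G.Gerbe L) {a b c : G.Loop} {v w : G₁} (hv : G.IsInertiaArrow a v b)
    (hw : G.IsInertiaArrow b w c) (h : G.t v = G.s w) (u : L a.1) :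
    g.rho a c (G.mul v w h) (hv.comp hw h) u = g.rho b c w hw (g.rho a b v hv u) := by
  by_cases hu : u = 0
  · rw [hu, map_zero, map_zero, map_zero]
  obtain ⟨p, rfl⟩ := exists_lift g v (hv.choose.symm.trans a.2.symm) hv.choose_spec.choose
  obtain ⟨q, rfl⟩ := exists_lift g w (hw.choose.symm.trans b.2.symm) hw.choose_spec.choose
  refine g.eq_rho _ rfl rfl (p.comp q) rfl hu (g.rho_ne_zero hw (g.rho_ne_zero hv hu)) ?_
  rw [g.ofLoop_rho hw rfl rfl q rfl (g.rho_ne_zero hv hu), g.ofLoop_rho hv rfl rfl p rfl hu,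
    conj_comp]

end Algebra

/-! ### Continuity of products and quotients in the extension -/

section Continuity

theorem eventually_mem_baseSet {G₁ : Type*} [TopologicalSpace G₁] {L : G₁ → Type*}
    [∀ a, TopologicalSpace (L a)] [TopologicalSpace (TotalSpace ℂ L)] [FiberBundle ℂ L]
    {X : Type*} [TopologicalSpace X] {r₀ : X} {f : X → G₁} (hf : ContinuousAt f r₀) :
    ∀ᶠ r in 𝓝 r₀, f r ∈ (trivializationAt ℂ L (f r₀)).baseSet :=
  hf ((trivializationAt ℂ L (f r₀)).open_baseSet.mem_nhds
    (mem_baseSet_trivializationAt ℂ L (f r₀)))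

variable {E G₀ G₁ : Type*} [NormedAddCommGroup E] [NormedSpace ℝ E]
  [TopologicalSpace G₀] [ChartedSpace E G₀] [TopologicalSpace G₁] [ChartedSpace E G₁]
  {G : OrbifoldGroupoid E G₀ G₁} {L : G₁ → Type*}
  [∀ a, AddCommGroup (L a)] [∀ a, Module ℂ (L a)] [∀ a, TopologicalSpace (L a)]
  [TopologicalSpace (TotalSpace ℂ L)] [FiberBundle ℂ L]
  {g : G.Gerbe L} {X : Type*} [TopologicalSpace X] {r₀ : X}

/-- The product exists only on composable pairs; its local smooth extension to an open set of pairs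
supplies the continuity. -/
theorem continuousAt_prod {f h : X → TotalSpace ℂ L} (hf : ContinuousAt f r₀)
    (hh : ContinuousAt h r₀) (hc : ∀ r, G.t (f r).1 = G.s (h r).1) :
    ContinuousAt (fun r => g.prod (f r) (h r) (hc r)) r₀ := by
  obtain ⟨U, hU, hpU, F, hF, hFe⟩ := g.smooth ⟨(f r₀, h r₀), hc r₀⟩
  have h1 : ContinuousAt (fun r => (f r, h r)) r₀ := hf.prodMk hh
  have h2 : ContinuousAt F (f r₀, h r₀) := hF.continuousOn.continuousAt (hU.mem_nhds hpU)
  refine (ContinuousAt.comp' (f := fun r => (f r, h r)) h2 h1).congr ?_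
  filter_upwards [h1 (hU.mem_nhds hpU)] with r hr
  exact hFe ⟨(f r, h r), hc r⟩ hr

variable [VectorBundle ℂ ℂ L]

variable (L) in
/-- Near any arrow the line bundle has a frame with constant coordinate in the preferred
trivialization; it is extended by arbitrary nonzero values. -/
theorem exists_localFrame (a₀ : G₁) : ∃ W : ∀ v, L v, (∀ v, W v ≠ 0) ∧
    ∀ v ∈ (trivializationAt ℂ L a₀).baseSet, (trivializationAt ℂ L a₀ ⟨v, W v⟩).2 = 1 := by
  have h : ∀ v, ∃ u : L v, u ≠ 0 ∧ (v ∈ (trivializationAt ℂ L a₀).baseSet →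
      (trivializationAt ℂ L a₀ ⟨v, u⟩).2 = 1) := by
    intro v
    by_cases hv : v ∈ (trivializationAt ℂ L a₀).baseSet
    · let φ := (trivializationAt ℂ L a₀).linearEquivAt ℂ v hv
      exact ⟨φ.symm 1, by simp, fun _ => φ.apply_symm_apply 1⟩
    · obtain ⟨u, hu⟩ := exists_fiber_ne_zero L v
      exact ⟨u, hu, fun h => absurd h hv⟩
  choose W hW using h
  exact ⟨W, fun v => (hW v).1, fun v => (hW v).2⟩

theorem trivializationAt_smul {a₀ v : G₁} (hv : v ∈ (trivializationAt ℂ L a₀).baseSet) (c : ℂ)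
    (u : L v) :
    (trivializationAt ℂ L a₀ ⟨v, c • u⟩).2 = c * (trivializationAt ℂ L a₀ ⟨v, u⟩).2 :=
  ((trivializationAt ℂ L a₀).linear ℂ hv).map_smul c u

theorem trivializationAt_ne_zero {a₀ v : G₁} (hv : v ∈ (trivializationAt ℂ L a₀).baseSet)
    {u : L v} (hu : u ≠ 0) : (trivializationAt ℂ L a₀ ⟨v, u⟩).2 ≠ 0 :=
  ((trivializationAt ℂ L a₀).linearEquivAt ℂ v hv).map_ne_zero_iff.2 hu

variable (L) in
theorem exists_continuousAt_section (a₀ : G₁) : ∃ W : ∀ v, L v, (∀ v, W v ≠ 0) ∧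
    ContinuousAt (fun v => (⟨v, W v⟩ : TotalSpace ℂ L)) a₀ := by
  obtain ⟨W, hW, hW'⟩ := exists_localFrame L a₀
  refine ⟨W, hW, (FiberBundle.continuousAt_totalSpace ℂ _).2 ⟨continuousAt_id, ?_⟩⟩
  refine continuousAt_const.congr (f := fun _ => (1 : ℂ)) ?_
  filter_upwards [eventually_mem_baseSet (L := L) (continuousAt_id (x := a₀))] with v hv
  exact (hW' v hv).symm

/-- In the trivialization at `(h r₀).1`, the factor `c` is a quotient of two continuous coordinates
with nonzero denominator at `r₀`. -/
theorem continuousAt_ratio {f h : X → TotalSpace ℂ L} {c : X → ℂ} (hf : ContinuousAt f r₀)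
    (hh : ContinuousAt h r₀) (hne : (h r₀).2 ≠ 0)
    (heq : ∀ᶠ r in 𝓝 r₀, f r = ⟨(h r).1, c r • (h r).2⟩) : ContinuousAt c r₀ := by
  have h0 : (f r₀).1 = (h r₀).1 := by rw [heq.self_of_nhds]
  obtain ⟨hh1, hh2⟩ := (FiberBundle.continuousAt_totalSpace ℂ _).1 hh
  obtain ⟨-, hf2⟩ := (FiberBundle.continuousAt_totalSpace ℂ _).1 hf
  rw [h0] at hf2
  refine (hf2.div hh2 (trivializationAt_ne_zero (mem_baseSet_trivializationAt ℂ L _) hne)).congr ?_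
  have hne' := hh2.eventually_ne
    (trivializationAt_ne_zero (mem_baseSet_trivializationAt ℂ L _) hne)
  filter_upwards [heq, eventually_mem_baseSet (L := L) hh1, hne'] with r hr hb hn
  rw [Pi.div_apply, hr, trivializationAt_smul hb, mul_div_cancel_right₀ _ hn]

theorem continuousAt_smul_section {f : X → G₁} {c : X → ℂ} {W : ∀ v, L v}
    (hf : ContinuousAt f r₀) (hc : ContinuousAt c r₀)
    (hW : ContinuousAt (fun v => (⟨v, W v⟩ : TotalSpace ℂ L)) (f r₀)) :
    ContinuousAt (fun r => (⟨f r, c r • W (f r)⟩ : TotalSpace ℂ L)) r₀ := by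
  refine (FiberBundle.continuousAt_totalSpace ℂ _).2 ⟨hf, ?_⟩
  have h1 : ContinuousAt (fun r => (⟨f r, W (f r)⟩ : TotalSpace ℂ L)) r₀ :=
    ContinuousAt.comp' (f := f) hW hf
  refine (hc.mul ((FiberBundle.continuousAt_totalSpace ℂ _).1 h1).2).congr ?_
  filter_upwards [eventually_mem_baseSet (L := L) hf] with r hr
  exact (trivializationAt_smul hr _ _).symm

theorem exists_smul_of_arrow_eq (W : ∀ v, L v) (hW : ∀ v, W v ≠ 0) (p : TotalSpace ℂ L) :
    ∃ c : ℂ, p = ⟨p.1, c • W p.1⟩ := by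
  obtain ⟨c, hc⟩ := exists_smul_eq_of_ne_zero (hW p.1) p.2
  exact ⟨c, by rw [hc]⟩

/-- Right division by a nonvanishing continuous family is continuous. -/
theorem continuousAt_of_prod_right {f h k : X → TotalSpace ℂ L}
    (hf : ContinuousAt (fun r => (f r).1) r₀) (hh : ContinuousAt h r₀) (hk : ContinuousAt k r₀)
    (hne : (h r₀).2 ≠ 0) (hc : ∀ r, G.t (f r).1 = G.s (h r).1)
    (heq : ∀ r, g.prod (f r) (h r) (hc r) = k r) : ContinuousAt f r₀ := by
  -- Writing `f = c • W` turns the equation into `k = c • (W · h)`, so `c` is a ratio of continuous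
  -- families and no continuity of inverses is needed.
  obtain ⟨W, hW, hWc⟩ := exists_continuousAt_section L (f r₀).1
  choose c hfc using fun r => exists_smul_of_arrow_eq W hW (f r)
  have h1 : ContinuousAt (fun r => (⟨(f r).1, W (f r).1⟩ : TotalSpace ℂ L)) r₀ :=
    ContinuousAt.comp' (f := fun r => (f r).1) hWc hf
  have hcc : ContinuousAt c r₀ := by
    refine continuousAt_ratio hk (continuousAt_prod (g := g) h1 hh hc)
      (g.θ_ne_zero _ _ _ _ _ (hW _) hne) (Filter.Eventually.of_forall fun r => ?_)
    rw [← heq r]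
    have key : ∀ p : TotalSpace ℂ L, ∀ hp : G.t p.1 = G.s (h r).1,
        p = ⟨(f r).1, c r • W (f r).1⟩ → g.prod p (h r) hp =
          ⟨G.mul (f r).1 (h r).1 (hc r), c r • g.θ (f r).1 (h r).1 (hc r) (W (f r).1) (h r).2⟩ := by
      rintro p hp rfl
      simp [prod]
    exact key _ _ (hfc r)
  exact (continuousAt_smul_section hf hcc hWc).congr
    (Filter.Eventually.of_forall fun r => (hfc r).symm)

/-- Left division by a nonvanishing continuous family is continuous. -/
theorem continuousAt_of_prod_left {f h k : X → TotalSpace ℂ L}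
    (hf : ContinuousAt (fun r => (f r).1) r₀) (hh : ContinuousAt h r₀) (hk : ContinuousAt k r₀)
    (hne : (h r₀).2 ≠ 0) (hc : ∀ r, G.t (h r).1 = G.s (f r).1)
    (heq : ∀ r, g.prod (h r) (f r) (hc r) = k r) : ContinuousAt f r₀ := by
  obtain ⟨W, hW, hWc⟩ := exists_continuousAt_section L (f r₀).1
  choose c hfc using fun r => exists_smul_of_arrow_eq W hW (f r)
  have h1 : ContinuousAt (fun r => (⟨(f r).1, W (f r).1⟩ : TotalSpace ℂ L)) r₀ :=
    ContinuousAt.comp' (f := fun r => (f r).1) hWc hf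
  have hcc : ContinuousAt c r₀ := by
    refine continuousAt_ratio hk (continuousAt_prod (g := g) hh h1 hc)
      (g.θ_ne_zero _ _ _ _ _ hne (hW _)) (Filter.Eventually.of_forall fun r => ?_)
    rw [← heq r]
    have key : ∀ p : TotalSpace ℂ L, ∀ hp : G.t (h r).1 = G.s p.1,
        p = ⟨(f r).1, c r • W (f r).1⟩ → g.prod (h r) p hp =
          ⟨G.mul (h r).1 (f r).1 (hc r), c r • g.θ (h r).1 (f r).1 (hc r) (h r).2 (W (f r).1)⟩ := by
      rintro p hp rfl
      simp [prod]
    exact key _ _ (hfc r)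
  exact (continuousAt_smul_section hf hcc hWc).congr
    (Filter.Eventually.of_forall fun r => (hfc r).symm)

/-- The unit section is continuous. -/
theorem continuousAt_one {x : X → G₀} (hx : ContinuousAt x r₀) :
    ContinuousAt (fun r => (1 : g.Hom (x r) (x r)).1) r₀ := by
  have he : ContinuousAt (fun r => G.e (x r)) r₀ :=
    ContinuousAt.comp' G.e_smooth.continuous.continuousAt hx
  obtain ⟨W, hW, hWc⟩ := exists_continuousAt_section L (G.e (x r₀))
  have h1 : ContinuousAt (fun r => (⟨G.e (x r), W (G.e (x r))⟩ : TotalSpace ℂ L)) r₀ :=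
    ContinuousAt.comp' (f := fun r => G.e (x r)) hWc he
  -- The unit is recovered from `1 · W = W` by right division.
  refine continuousAt_of_prod_right (g := g) (he.congr (Filter.Eventually.of_forall fun r =>
      Hom.one_val_arrow.symm)) h1 h1 (hW _)
    (fun r => (1 : g.Hom (x r) (x r)).2.2.2.trans (G.s_e _).symm) fun r => ?_
  exact congrArg Subtype.val
    (Hom.one_comp (⟨⟨_, W (G.e (x r))⟩, hW _, G.s_e _, G.t_e _⟩ : g.Hom (x r) (x r)))

end Continuity

/-! ### Continuous families of roots of unity -/

section RootsOfUnity

/-- A continuous family of roots of unity of bounded order is locally constant. -/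
theorem eventually_eq_of_pow_eq_one {X : Type*} [TopologicalSpace X] {r₀ : X} {c : X → ℂ}
    (hc : ContinuousAt c r₀) {m : ℕ} (hm : 0 < m) (h : ∀ᶠ r in 𝓝 r₀, c r ^ m = 1) :
    ∀ᶠ r in 𝓝 r₀, c r = c r₀ := by
  have hfin : {z : ℂ | z ^ m = 1}.Finite := by
    refine (Polynomial.nthRoots m (1 : ℂ)).toFinset.finite_toSet.subset fun z hz => ?_
    simpa [Polynomial.mem_nthRoots hm] using hz
  have hcl : IsClosed ({z : ℂ | z ^ m = 1} \ {c r₀}) := (hfin.subset Set.sdiff_subset).isClosed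
  filter_upwards [h, hc (hcl.isOpen_compl.mem_nhds fun h => h.2 rfl)] with r h1 h2
  by_contra h3
  exact h2 ⟨h1, h3⟩

end RootsOfUnity

end Gerbe

/-! ### Finiteness of isotropy and openness of the units -/

section Isotropy

variable {E G₀ G₁ : Type*} [NormedAddCommGroup E] [NormedSpace ℝ E]
  [TopologicalSpace G₀] [ChartedSpace E G₀] [TopologicalSpace G₁] [ChartedSpace E G₁]
  (G : OrbifoldGroupoid E G₀ G₁)

theorem exists_isOpen_injOn_s (a : G₁) : ∃ U, IsOpen U ∧ a ∈ U ∧ Set.InjOn G.s U :=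
  G.s_etale.isLocalHomeomorph.isLocallyInjective a

/-- The isotropy groups of a proper étale groupoid are finite, of locally bounded order. -/
theorem exists_isotropy_bound (x₀ : G₀) : ∃ N : ℕ, ∀ᶠ x in 𝓝 x₀,
    ∃ f : {a : G₁ // G.s a = x ∧ G.t a = x} → Fin N, Function.Injective f := by
  -- Each `O a` contains at most one arrow with a given source, so the number of these sets covering
  -- an isotropy group bounds its order.
  choose O hO haO hinj using G.exists_isOpen_injOn_s
  obtain ⟨T, -, hT⟩ := (G.proper.isCompact_preimage (isCompact_singleton (x := (x₀, x₀)))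
    ).elim_nhds_subcover O fun a _ => (hO a).mem_nhds (haO a)
  refine ⟨T.card, ?_⟩
  have hopen : IsOpen (⋃ a ∈ T, O a) := isOpen_biUnion fun a _ => hO a
  -- The map `(s, t)` is closed, so the finite cover of the fibre over `(x₀, x₀)` still covers the
  -- nearby fibres.
  have hev := G.proper.isClosedMap.eventually_nhds_fiber (p := fun a => a ∈ ⋃ a ∈ T, O a) (x₀, x₀)
    fun a ha => hopen.mem_nhds (hT ha)
  have hdiag : Filter.Tendsto (fun x : G₀ => (x, x)) (𝓝 x₀) (𝓝 (x₀, x₀)) :=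
    (continuous_id.prodMk continuous_id).tendsto x₀
  filter_upwards [hdiag.eventually hev] with x hx
  have hmem : ∀ a : {a : G₁ // G.s a = x ∧ G.t a = x}, ∃ i : T, a.1 ∈ O i := by
    intro a
    have := hx a.1 (by simp [a.2.1, a.2.2])
    simpa using this
  choose i hi using hmem
  refine ⟨fun a => T.equivFin (i a), fun a b hab => Subtype.ext ?_⟩
  have hab' : i a = i b := T.equivFin.injective hab
  exact hinj (i a) (hi a) (hab' ▸ hi b) (a.2.1.trans b.2.1.symm)

/-- The units form an open set of arrows. -/
theorem eventually_eq_e (x : G₀) : ∀ᶠ a in 𝓝 (G.e x), a = G.e (G.s a) := by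
  obtain ⟨U, hU, hxU, hinj⟩ := G.exists_isOpen_injOn_s (G.e x)
  have hcont : Continuous fun a => G.e (G.s a) :=
    G.e_smooth.continuous.comp G.s_etale.isLocalHomeomorph.continuous
  have h1 : ∀ᶠ a in 𝓝 (G.e x), G.e (G.s a) ∈ U :=
    hcont.continuousAt (hU.mem_nhds (by rwa [G.s_e]))
  filter_upwards [hU.mem_nhds hxU, h1] with a ha ha'
  exact hinj ha ha' (G.s_e _).symm

end Isotropy

namespace Gerbe

/-! ### Torsion in central extensions of finite groups -/

section Torsion

/-- Raising to the power of the index of the centre is a homomorphism into the centre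
(`MonoidHom.transferCenterPow`), an abelian group, where a product of `m`-torsion elements is
`m`-torsion. -/
theorem partialProd_pow_eq_one {Γ : Type*} [Group Γ] (hfin : (Subgroup.center Γ).index ≠ 0)
    {m n : ℕ} (l : Fin n → Γ) (hl : ∀ i, l i ^ m = 1) (j : Fin (n + 1)) :
    Fin.partialProd l j ^ ((Subgroup.center Γ).index * m) = 1 := by
  have : (Subgroup.center Γ).FiniteIndex := ⟨hfin⟩
  have key : ∀ u, u ^ ((Subgroup.center Γ).index * m) = 1 ↔
      (MonoidHom.transferCenterPow Γ u) ^ m = 1 := fun u => by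
    rw [pow_mul, ← MonoidHom.transferCenterPow_apply, ← Subgroup.coe_pow, OneMemClass.coe_eq_one]
  induction j using Fin.induction with
  | zero => simp
  | succ i ih =>
    have hcomm : Commute (MonoidHom.transferCenterPow Γ (Fin.partialProd l i.castSucc))
        (MonoidHom.transferCenterPow Γ (l i)) :=
      Subtype.ext (Subgroup.mem_center_iff.1 (Subtype.property _) _).symm
    rw [Fin.partialProd_succ, key, map_mul, hcomm.mul_pow, (key _).1 ih, ← map_pow, hl, map_one,
      mul_one]

variable {E G₀ G₁ : Type*} [NormedAddCommGroup E] [NormedSpace ℝ E]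
  [TopologicalSpace G₀] [ChartedSpace E G₀] [TopologicalSpace G₁] [ChartedSpace E G₁]
  {G : OrbifoldGroupoid E G₀ G₁} {L : G₁ → Type*}
  [∀ a, AddCommGroup (L a)] [∀ a, Module ℂ (L a)] [∀ a, TopologicalSpace (L a)]
  [TopologicalSpace (TotalSpace ℂ L)] [FiberBundle ℂ L] [VectorBundle ℂ ℂ L]
  {g : G.Gerbe L} {x : G₀}

theorem smul_one_mem_center (c : ℂˣ) : c • (1 : g.Hom x x) ∈ Subgroup.center (g.Hom x x) := by
  rw [Subgroup.mem_center_iff]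
  intro u
  rw [mul_smul_comm, smul_mul_assoc, mul_one, one_mul]

/-- Elements over the same arrow differ by a central scalar, so the quotient by the centre injects
into the isotropy group. -/
theorem index_center_bound {N : ℕ} {f : {a : G₁ // G.s a = x ∧ G.t a = x} → Fin N}
    (hf : Function.Injective f) : (Subgroup.center (g.Hom x x)).index ≠ 0 ∧
      (Subgroup.center (g.Hom x x)).index ≤ N := by
  let F : g.Hom x x ⧸ Subgroup.center (g.Hom x x) → Fin N :=
    fun p => f ⟨p.out.1.1, p.out.2.2⟩
  have hF : Function.Injective F := by
    intro p q hpq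
    have h1 : p.out.1.1 = q.out.1.1 := congrArg Subtype.val (hf hpq)
    obtain ⟨c, hc⟩ := Hom.exists_smul_eq _ _ h1
    rw [← p.out_eq', ← q.out_eq', QuotientGroup.eq, hc, mul_smul_comm, inv_mul_cancel]
    exact smul_one_mem_center c
  have : Finite (g.Hom x x ⧸ Subgroup.center (g.Hom x x)) := Finite.of_injective F hF
  refine ⟨Subgroup.index_ne_zero_of_finite, ?_⟩
  rw [Subgroup.index_eq_card]
  simpa using Nat.card_le_card_of_injective F hF

variable (g) in
/-- Near any point, products of elements of the central extension of bounded order have bounded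
order. -/
theorem exists_pow_partialProd_eq_one (x₀ : G₀) : ∃ N : ℕ, 0 < N ∧ ∀ᶠ x in 𝓝 x₀,
    ∀ (m n : ℕ) (l : Fin n → g.Hom x x), (∀ i, l i ^ m = 1) → ∀ j,
      Fin.partialProd l j ^ (N * m) = 1 := by
  obtain ⟨N, hN⟩ := G.exists_isotropy_bound x₀
  -- The index of the centre varies with `x` but is at most `N`, so it divides `N!`, an exponent
  -- uniform in `x`.
  refine ⟨N.factorial, N.factorial_pos, ?_⟩
  filter_upwards [hN] with x ⟨f, hf⟩ m n l hl j
  obtain ⟨h0, hle⟩ := index_center_bound (g := g) hf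
  obtain ⟨k, hk⟩ := Nat.dvd_factorial (Nat.pos_of_ne_zero h0) hle
  rw [hk, mul_right_comm, pow_mul, partialProd_pow_eq_one h0 l hl, one_pow]

/-- Pigeonhole: two powers of `u` lie over the same arrow of the finite isotropy group, so their
quotient is a scalar. -/
theorem exists_pow_arrow_eq_e (u : g.Hom x x) : ∃ n : ℕ, (u ^ (n + 1)).1.1 = G.e x := by
  obtain ⟨N, hN⟩ := G.exists_isotropy_bound x
  obtain ⟨f, hf⟩ := hN.self_of_nhds
  have hfin : Finite {a : G₁ // G.s a = x ∧ G.t a = x} := Finite.of_injective f hf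
  have key : ∀ i j : ℕ, i < j → (u ^ i).1.1 = (u ^ j).1.1 →
      ∃ n : ℕ, (u ^ (n + 1)).1.1 = G.e x := by
    intro i j hij h
    obtain ⟨c, hc⟩ := Hom.exists_smul_eq _ _ h
    obtain ⟨n, rfl⟩ := Nat.exists_eq_add_of_lt hij
    refine ⟨n, ?_⟩
    have h1 : u ^ (n + 1) = c • 1 := by
      apply mul_right_cancel (b := u ^ i)
      rw [← pow_add, smul_mul_assoc, one_mul, ← hc]
      congr 1
      ring
    rw [h1, Hom.smul_arrow, Hom.one_val_arrow]
  obtain ⟨i, j, hij, h⟩ := Finite.exists_ne_map_eq_of_infinite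
    fun i : ℕ => (⟨(u ^ i).1.1, (u ^ i).2.2⟩ : {a : G₁ // G.s a = x ∧ G.t a = x})
  have h' : (u ^ i).1.1 = (u ^ j).1.1 := congrArg Subtype.val h
  rcases lt_or_gt_of_ne hij with hlt | hlt
  · exact key i j hlt h'
  · exact key j i hlt h'.symm

end Torsion

/-! ### Smooth torsion frames -/

section SmoothFrames

/-- A smooth branch of the inverse `n`-th root. -/
theorem exists_inverse_root {c₀ : ℂ} (hc₀ : c₀ ≠ 0) {n : ℕ} (hn : n ≠ 0) :
    ∃ h : ℂ → ℂ, (∀ z, z ≠ 0 → h z ^ n * z = 1) ∧ ∀ᶠ z in 𝓝 c₀, ContDiffAt ℝ ∞ h z := by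
  obtain ⟨r, hr⟩ := IsAlgClosed.exists_pow_nat_eq c₀⁻¹ (Nat.pos_of_ne_zero hn)
  -- The algebraic identity holds for all `z ≠ 0` whatever the branch of `log`; dividing by `c₀`
  -- keeps the cut away from `c₀`, where smoothness is wanted.
  refine ⟨fun z => r * Complex.exp (-Complex.log (z / c₀) / n), fun z hz => ?_, ?_⟩
  · rw [mul_pow, hr, ← Complex.exp_nat_mul, mul_div_cancel₀ _ (Nat.cast_ne_zero.2 hn),
      Complex.exp_neg, Complex.exp_log (div_ne_zero hz hc₀)]
    field_simp
  · have hcont : ContinuousAt (fun z : ℂ => z / c₀) c₀ := by fun_prop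
    have hev : ∀ᶠ z in 𝓝 c₀, z / c₀ ∈ Complex.slitPlane :=
      hcont (Complex.isOpen_slitPlane.mem_nhds (by simp [hc₀]))
    filter_upwards [hev] with z hz
    have h1 : ContDiffAt ℂ ∞ (fun z => r * Complex.exp (-Complex.log (z / c₀) / n)) z := by
      have h2 : ContDiffAt ℂ ∞ (fun z => z / c₀) z := contDiffAt_id.div_const c₀
      exact contDiffAt_const.mul ((((Complex.contDiffAt_log hz).comp z h2).neg.div_const _).cexp)
    exact h1.restrict_scalars ℝ

variable {E G₀ G₁ : Type*} [NormedAddCommGroup E] [NormedSpace ℝ E]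
  [TopologicalSpace G₀] [ChartedSpace E G₀] [TopologicalSpace G₁] [ChartedSpace E G₁]
  {G : OrbifoldGroupoid E G₀ G₁} {L : G₁ → Type*}
  [∀ a, AddCommGroup (L a)] [∀ a, Module ℂ (L a)] [∀ a, TopologicalSpace (L a)]
  [TopologicalSpace (TotalSpace ℂ L)] [FiberBundle ℂ L] [VectorBundle ℂ ℂ L]

/-- Powers of a smooth section over the loops extend smoothly. -/
theorem exists_smooth_pow (g : G.Gerbe L) (a : G.Loop) (W : ∀ v, L v) (hW : ∀ v, W v ≠ 0)
    {V : Set G₁} (hV : IsOpen V) (haV : a.1 ∈ V)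
    (hWs : ContMDiffOn 𝓘(ℝ, E) (𝓘(ℝ, E).prod 𝓘(ℝ, ℂ)) ∞
      (fun x => TotalSpace.mk' ℂ x (W x)) V) (k : ℕ) :
    ∃ U : Set G₁, IsOpen U ∧ a.1 ∈ U ∧ ∃ P : G₁ → TotalSpace ℂ L,
      ContMDiffOn 𝓘(ℝ, E) (𝓘(ℝ, E).prod 𝓘(ℝ, ℂ)) ∞ P U ∧
      ∀ b : G.Loop, b.1 ∈ U → P b.1 = (Hom.ofLoop g b rfl (hW b.1) ^ (k + 1)).1 := by
  induction k with
  | zero =>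
    refine ⟨V, hV, haV, _, hWs, fun b _ => ?_⟩
    rw [zero_add, pow_one]
    rfl
  | succ k ih =>
    obtain ⟨U, hU, haU, P, hP, hPe⟩ := ih
    have hcomp : ∀ b : G.Loop, b.1 ∈ U → G.t (P b.1).1 = G.s b.1 := fun b hb => by
      rw [hPe b hb]
      exact (Hom.ofLoop g b rfl (hW b.1) ^ (k + 1)).2.2.2
    -- Away from loops `P x` and `W x` need not be composable, so the extension `F` of the product
    -- replaces it there.
    obtain ⟨O, hO, hpO, F, hF, hFe⟩ :=
      g.smooth ⟨(P a.1, TotalSpace.mk' ℂ a.1 (W a.1)), hcomp a haU⟩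
    have hQ : ContMDiffOn 𝓘(ℝ, E) ((𝓘(ℝ, E).prod 𝓘(ℝ, ℂ)).prod (𝓘(ℝ, E).prod 𝓘(ℝ, ℂ))) ∞
        (fun x => (P x, TotalSpace.mk' ℂ x (W x))) (U ∩ V) :=
      (hP.mono Set.inter_subset_left).prodMk (hWs.mono Set.inter_subset_right)
    refine ⟨(U ∩ V) ∩ (fun x => (P x, TotalSpace.mk' ℂ x (W x))) ⁻¹' O,
      hQ.continuousOn.isOpen_inter_preimage (hU.inter hV) hO, ⟨⟨haU, haV⟩, hpO⟩,
      fun x => F (P x, TotalSpace.mk' ℂ x (W x)),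
      hF.comp (hQ.mono Set.inter_subset_left) fun x hx => hx.2, fun b hb => ?_⟩
    refine (hFe ⟨(P b.1, TotalSpace.mk' ℂ b.1 (W b.1)), hcomp b hb.1.1⟩ hb.2).trans ?_
    rw [pow_succ]
    have key : ∀ (p : TotalSpace ℂ L) (hp : G.t p.1 = G.s b.1)
        (q : g.Hom (G.s b.1) (G.s b.1)), p = q.1 →
        g.prod p ⟨b.1, W b.1⟩ hp = (q * Hom.ofLoop g b rfl (hW b.1)).1 := by
      rintro p hp q rfl
      rfl
    exact key _ _ _ (hPe b hb.1.1)

/-- Near any loop there is a smooth frame whose values over loops have finite order in the central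
extension. -/
theorem exists_torsion_section [VectorBundle ℝ ℂ L] [ContMDiffVectorBundle ∞ ℂ L 𝓘(ℝ, E)]
    (g : G.Gerbe L) (a : G.Loop) :
    ∃ n : ℕ, 0 < n ∧ ∃ (U : Set G₁) (τ : ∀ x, L x), IsOpen U ∧ a.1 ∈ U ∧
      ContMDiffOn 𝓘(ℝ, E) (𝓘(ℝ, E).prod 𝓘(ℝ, ℂ)) ∞ (fun x => TotalSpace.mk' ℂ x (τ x)) U ∧
      ∀ b : G.Loop, b.1 ∈ U → ∃ hb : τ b.1 ≠ 0, Hom.ofLoop g b rfl hb ^ n = 1 := by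
  obtain ⟨W, hW, hWφ⟩ := exists_localFrame L a.1
  let φ := trivializationAt ℂ L a.1
  have haφ : a.1 ∈ φ.baseSet := mem_baseSet_trivializationAt ℂ L a.1
  have hWs : ContMDiffOn 𝓘(ℝ, E) (𝓘(ℝ, E).prod 𝓘(ℝ, ℂ)) ∞
      (fun x => TotalSpace.mk' ℂ x (W x)) φ.baseSet := by
    intro x hx
    refine ContMDiffAt.contMDiffWithinAt ((φ.contMDiffAt_section_iff hx).2 ?_)
    refine (contMDiffAt_const (c := (1 : ℂ))).congr_of_eventuallyEq ?_
    filter_upwards [φ.open_baseSet.mem_nhds hx] with y hy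
    exact hWφ y hy
  obtain ⟨n, hn⟩ := exists_pow_arrow_eq_e (Hom.ofLoop g a rfl (hW a.1))
  obtain ⟨U₁, hU₁, haU₁, P, hP, hPe⟩ := exists_smooth_pow g a W hW φ.open_baseSet haφ hWs n
  obtain ⟨U₂, hU₂, haU₂, Q, hQ, hQe⟩ := exists_smooth_pow g a W hW φ.open_baseSet haφ hWs (n + 1)
  have hunit : ∀ᶠ x in 𝓝 a.1, (P x).1 = G.e (G.s (P x).1) := by
    have h1 : ContinuousAt (fun x => (P x).1) a.1 :=
      ContinuousAt.comp' (f := P) (FiberBundle.continuous_proj ℂ L).continuousAt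
        (hP.continuousOn.continuousAt (hU₁.mem_nhds haU₁))
    have h2 : (P a.1).1 = G.e (G.s a.1) := by rw [hPe a haU₁, hn]
    have h3 := G.eventually_eq_e (G.s a.1)
    rw [← h2] at h3
    exact h1.eventually h3
  -- Since `W ^ (n + 1) = c • 1` lies over a unit, perhaps outside the domain of `φ`, the scalar is
  -- read off one power later: `Q = W ^ (n + 2) = c • W` lies over the loop itself, where `W` has
  -- coordinate `1`.
  have hscal : ∀ b : G.Loop, b.1 ∈ U₁ → b.1 ∈ U₂ → b.1 ∈ φ.baseSet →
      (P b.1).1 = G.e (G.s (P b.1).1) → ∃ c : ℂˣ,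
        Hom.ofLoop g b rfl (hW b.1) ^ (n + 1) = c • 1 ∧ Q b.1 = ⟨b.1, (c : ℂ) • W b.1⟩ ∧
          (φ (Q b.1)).2 = c := by
    intro b hb1 hb2 hbφ hbe
    rw [hPe b hb1] at hbe
    obtain ⟨c, hc⟩ := Hom.exists_smul_one_eq (Hom.ofLoop g b rfl (hW b.1) ^ (n + 1)) (by
      rw [hbe, (Hom.ofLoop g b rfl (hW b.1) ^ (n + 1)).2.2.1])
    have hQb : Q b.1 = ⟨b.1, (c : ℂ) • W b.1⟩ := by
      rw [hQe b hb2, pow_succ, hc, ← Hom.one_def, smul_mul_assoc, one_mul]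
      rfl
    refine ⟨c, hc, hQb, ?_⟩
    rw [hQb, trivializationAt_smul hbφ, hWφ _ hbφ, mul_one]
  obtain ⟨c₀, -, hQa, hca⟩ := hscal a haU₁ haU₂ haφ hunit.self_of_nhds
  obtain ⟨h, hroot, hsm⟩ := exists_inverse_root c₀.ne_zero n.succ_ne_zero
  have hQsm : ∀ᶠ x in 𝓝 a.1, ContMDiffAt 𝓘(ℝ, E) 𝓘(ℝ, ℂ) ∞ (fun x => (φ (Q x)).2) x := by
    have h1 : ContinuousAt (fun x => (Q x).1) a.1 :=
      ContinuousAt.comp' (f := Q) (FiberBundle.continuous_proj ℂ L).continuousAt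
        (hQ.continuousOn.continuousAt (hU₂.mem_nhds haU₂))
    have h2 : ∀ᶠ x in 𝓝 a.1, (Q x).1 ∈ φ.baseSet :=
      h1.eventually (φ.open_baseSet.mem_nhds (by
        change (Q a.1).1 ∈ φ.baseSet
        rwa [hQa]))
    filter_upwards [h2, hU₂.mem_nhds haU₂] with x hx hxU
    exact ((φ.contMDiffAt_iff (φ.mem_source.2 hx)).1 (hQ.contMDiffAt (hU₂.mem_nhds hxU))).2
  have hhsm : ∀ᶠ x in 𝓝 a.1, ContDiffAt ℝ ∞ h (φ (Q x)).2 := by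
    have h1 : ContinuousAt (fun x => (φ (Q x)).2) a.1 := hQsm.self_of_nhds.continuousAt
    rw [← hca] at hsm
    exact h1.eventually hsm
  have hall := (hU₁.eventually_mem haU₁).and ((hU₂.eventually_mem haU₂).and
    ((φ.open_baseSet.eventually_mem haφ).and (hunit.and (hQsm.and hhsm))))
  obtain ⟨U, hUall, hU, haU⟩ := eventually_nhds_iff.1 hall
  -- Over loops the coordinate of `Q` is `c`, so `h` of it is an inverse `(n + 1)`-st root of `c`;
  -- elsewhere it is merely a smooth extension.
  refine ⟨n + 1, n.succ_pos, U, fun x => h (φ (Q x)).2 • W x, hU, haU, fun x hx => ?_,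
    fun b hb => ?_⟩
  · obtain ⟨-, -, hxφ, -, hq, hh⟩ := hUall x hx
    refine ContMDiffAt.contMDiffWithinAt ((φ.contMDiffAt_section_iff hxφ).2 ?_)
    have h1 : ContMDiffAt 𝓘(ℝ, E) 𝓘(ℝ, ℂ) ∞ (fun x => h (φ (Q x)).2) x :=
      ContMDiffAt.comp x hh.contMDiffAt hq
    refine h1.congr_of_eventuallyEq ?_
    filter_upwards [φ.open_baseSet.mem_nhds hxφ] with y hy
    rw [trivializationAt_smul hy, hWφ y hy, mul_one]
  · obtain ⟨hb1, hb2, hbφ, hbe, -, -⟩ := hUall b.1 hb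
    obtain ⟨c, hc, -, hcb⟩ := hscal b hb1 hb2 hbφ hbe
    have hr := hroot c c.ne_zero
    have hhc : h c ≠ 0 := by
      intro h0
      rw [h0, zero_pow n.succ_ne_zero, zero_mul] at hr
      exact zero_ne_one hr
    simp only [hcb]
    refine ⟨smul_ne_zero hhc (hW _), ?_⟩
    have h1 := Hom.ofLoop_smul (g := g) b rfl (hW b.1) (Units.mk0 (h c) hhc)
      (smul_ne_zero hhc (hW _))
    have h2 : Units.mk0 (h c) hhc ^ (n + 1) * c = 1 := Units.ext hr
    rw [show Hom.ofLoop g b rfl (smul_ne_zero hhc (hW b.1)) = _ from h1, smul_pow, hc, smul_smul,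
      h2, one_smul]

end SmoothFrames

/-! ### Flat frames and the flat line orbibundle -/

section FlatFrames

variable {E G₀ G₁ : Type*} [NormedAddCommGroup E] [NormedSpace ℝ E]
  [TopologicalSpace G₀] [ChartedSpace E G₀] [TopologicalSpace G₁] [ChartedSpace E G₁]
  {G : OrbifoldGroupoid E G₀ G₁} {L : G₁ → Type*}
  [∀ a, AddCommGroup (L a)] [∀ a, Module ℂ (L a)] [∀ a, TopologicalSpace (L a)]
  [TopologicalSpace (TotalSpace ℂ L)] [FiberBundle ℂ L] [VectorBundle ℂ ℂ L]

/-- A vector over a loop is `n`-torsion if its `n`-th power in the central extension is `1`. -/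
def IsTorsion (g : G.Gerbe L) (n : ℕ) (b : G.Loop) (u : L b.1) : Prop :=
  ∃ hu : u ≠ 0, Hom.ofLoop g b rfl hu ^ n = 1

/-- The flat frames: frames which locally are restrictions of smooth sections and whose values
locally have bounded order in the central extension. -/
structure IsFlatFrame (g : G.Gerbe L) (S : Set G.Loop) (U : Set S) (σ : ∀ a : S, L a.1.1) :
    Prop where
  isOpen : IsOpen U
  torsion : ∀ a ∈ U, ∃ n : ℕ, 0 < n ∧ ∀ᶠ b in 𝓝 a, g.IsTorsion n b.1 (σ b)
  smooth : ∀ a ∈ U, ∃ (W : Set G₁) (τ : ∀ x : G₁, L x), IsOpen W ∧ a.1.1 ∈ W ∧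
    ContMDiffOn 𝓘(ℝ, E) (𝓘(ℝ, E).prod 𝓘(ℝ, ℂ)) ∞ (fun x => TotalSpace.mk' ℂ x (τ x)) W ∧
    ∀ b ∈ U, b.1.1 ∈ W → σ b = τ b.1.1

variable {g : G.Gerbe L} {S : Set G.Loop}

theorem IsTorsion.pow_eq_one {n m : ℕ} {b : G.Loop} {u w : L b.1} (hu : g.IsTorsion n b u)
    (hw : g.IsTorsion m b w) {c : ℂ} (h : u = c • w) : c ^ (n * m) = 1 := by
  obtain ⟨hu0, hu⟩ := hu
  obtain ⟨hw0, hw⟩ := hw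
  have hc : c ≠ 0 := by
    rintro rfl
    exact hu0 (h.trans (zero_smul _ _))
  have h1 : Hom.ofLoop g b rfl hu0 = Units.mk0 c hc • Hom.ofLoop g b rfl hw0 := by
    subst h
    rfl
  have h2 : Units.mk0 c hc ^ (n * m) • (1 : g.Hom (G.s b.1) (G.s b.1)) = (1 : ℂˣ) • 1 := by
    calc Units.mk0 c hc ^ (n * m) • (1 : g.Hom (G.s b.1) (G.s b.1))
        = (Units.mk0 c hc • Hom.ofLoop g b rfl hw0) ^ (n * m) := by
          rw [smul_pow, mul_comm n m, pow_mul (Hom.ofLoop g b rfl hw0), hw, one_pow]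
      _ = (1 : ℂˣ) • 1 := by rw [← h1, pow_mul, hu, one_pow, one_smul]
  have h3 := congrArg Units.val (Hom.smul_left_cancel h2)
  simpa using h3

/-- Conjugation is a group isomorphism and preserves orders; this is what makes `ρ` flat. -/
theorem IsTorsion.rho {n : ℕ} {a b : G.Loop} {v : G₁} (hv : G.IsInertiaArrow a v b) {u : L a.1}
    (hu : g.IsTorsion n a u) : g.IsTorsion n b (g.rho a b v hv u) := by
  obtain ⟨hu0, hu⟩ := hu
  obtain ⟨w, hw⟩ := Hom.exists_lift g v (hv.choose.symm.trans a.2.symm) hv.choose_spec.choose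
  refine ⟨g.rho_ne_zero hv hu0, ?_⟩
  rw [g.ofLoop_rho hv rfl rfl w hw hu0, ← map_pow, hu, map_one]

/-- Two continuous families of vectors of bounded order differ by a locally constant factor. -/
theorem eventually_eq_smul_of_isTorsion {X : Type*} [TopologicalSpace X] {r₀ : X} {β : X → G.Loop}
    {u w : ∀ r, L (β r).1} (hu : ContinuousAt (fun r => (⟨(β r).1, u r⟩ : TotalSpace ℂ L)) r₀)
    (hw : ContinuousAt (fun r => (⟨(β r).1, w r⟩ : TotalSpace ℂ L)) r₀) {n m : ℕ} (hn : 0 < n)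
    (hm : 0 < m) (hun : ∀ᶠ r in 𝓝 r₀, g.IsTorsion n (β r) (u r))
    (hwm : ∀ᶠ r in 𝓝 r₀, g.IsTorsion m (β r) (w r)) {c : ℂ} (hc : u r₀ = c • w r₀) :
    ∀ᶠ r in 𝓝 r₀, u r = c • w r := by
  -- The ratio gets the value `0` where `w` vanishes, which does not happen near `r₀`.
  have hex : ∀ r, ∃ k : ℂ, w r ≠ 0 → u r = k • w r := fun r => by
    by_cases h : w r = 0
    · exact ⟨0, fun h' => absurd h h'⟩
    · obtain ⟨k, hk⟩ := exists_smul_eq_of_ne_zero h (u r)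
      exact ⟨k, fun _ => hk.symm⟩
  choose k hk using hex
  have hw0 : w r₀ ≠ 0 := hwm.self_of_nhds.1
  have hkc : ContinuousAt k r₀ := by
    refine continuousAt_ratio hu hw hw0 ?_
    filter_upwards [hwm] with r hr
    rw [hk r hr.1]
  have hk0 : k r₀ = c := smul_left_injective ℂ hw0 ((hk r₀ hw0).symm.trans hc)
  have hpow : ∀ᶠ r in 𝓝 r₀, k r ^ (n * m) = 1 := by
    filter_upwards [hun, hwm] with r h1 h2
    exact h1.pow_eq_one h2 (hk r h2.1)
  filter_upwards [eventually_eq_of_pow_eq_one hkc (Nat.mul_pos hn hm) hpow, hwm] with r h1 h2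
  rw [hk r h2.1, h1, hk0]

theorem IsFlatFrame.continuousAt {U : Set S} {σ : ∀ a : S, L a.1.1} (h : g.IsFlatFrame S U σ)
    {a : S} (ha : a ∈ U) :
    ContinuousAt (fun b : S => (⟨b.1.1, σ b⟩ : TotalSpace ℂ L)) a := by
  obtain ⟨W, τ, hW, haW, hτ, hστ⟩ := h.smooth a ha
  have hval : Continuous fun b : S => b.1.1 := continuous_subtype_val.comp continuous_subtype_val
  have h1 : ContinuousAt (fun b : S => (⟨b.1.1, τ b.1.1⟩ : TotalSpace ℂ L)) a :=
    ContinuousAt.comp' (f := fun b : S => b.1.1)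
      (hτ.continuousOn.continuousAt (hW.mem_nhds haW)) hval.continuousAt
  refine h1.congr ?_
  filter_upwards [h.isOpen.mem_nhds ha, hval.continuousAt (hW.mem_nhds haW)] with b hb hbW
  rw [hστ b hb hbW]

variable (g S) in
theorem exists_isFlatFrame [VectorBundle ℝ ℂ L] [ContMDiffVectorBundle ∞ ℂ L 𝓘(ℝ, E)] (a : S) :
    ∃ U σ, g.IsFlatFrame S U σ ∧ a ∈ U := by
  obtain ⟨n, hn, W, τ, hW, haW, hτ, htor⟩ := g.exists_torsion_section a.1
  have hval : Continuous fun b : S => b.1.1 := continuous_subtype_val.comp continuous_subtype_val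
  refine ⟨(fun b : S => b.1.1) ⁻¹' W, fun b => τ b.1.1, ⟨hW.preimage hval, fun b hb => ?_,
    fun b hb => ⟨W, τ, hW, hb, hτ, fun _ _ _ => rfl⟩⟩, haW⟩
  refine ⟨n, hn, ?_⟩
  filter_upwards [(hW.preimage hval).mem_nhds hb] with d hd
  exact htor d.1 hd

/-- Transport along arrows of `∧G` of a continuous family of vectors is continuous. -/
theorem continuousAt_rho {X : Type*} [TopologicalSpace X] {r₀ : X} {α β : X → G.Loop} {v : X → G₁}
    (hv : ∀ r, G.IsInertiaArrow (α r) (v r) (β r)) {u : ∀ r, L (α r).1}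
    (hu : ContinuousAt (fun r => (⟨(α r).1, u r⟩ : TotalSpace ℂ L)) r₀)
    (hvc : ContinuousAt v r₀) (hβ : ContinuousAt (fun r => (β r).1) r₀) :
    ContinuousAt (fun r => (⟨(β r).1, g.rho (α r) (β r) (v r) (hv r) (u r)⟩ : TotalSpace ℂ L))
      r₀ := by
  obtain ⟨W, hW, hWc⟩ := exists_continuousAt_section L (v r₀)
  have h1 : ContinuousAt (fun r => (⟨v r, W (v r)⟩ : TotalSpace ℂ L)) r₀ :=
    ContinuousAt.comp' (f := v) hWc hvc
  -- The equation `W · ρ(u) = u · W` exhibits `ρ(u)` as a left quotient.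
  exact continuousAt_of_prod_left (g := g) hβ h1
    (continuousAt_prod (g := g) hu h1 fun r => (hv r).choose) (hW _)
    (fun r => (hv r).choose_spec.choose) fun r => (g.rho_spec (hv r) (u r) (W (v r))).symm

variable (g S) in
/-- The flat line orbibundle over the sectors defined by the gluing maps `ρ`. -/
noncomputable def flatLineOrbibundle [VectorBundle ℝ ℂ L]
    [ContMDiffVectorBundle ∞ ℂ L 𝓘(ℝ, E)] :
    G.FlatLineOrbibundle S (fun a => L a.1.1) where
  finrank_eq_one a := finrank_fiber L a.1.1
  act a b v hv := g.rho a.1 b.1 v hv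
  act_id a u := g.rho_id a.1 u
  act_comp _ _ _ _ _ hv hw h u := g.rho_comp hv hw h u
  IsFrame := g.IsFlatFrame S
  isOpen_of_isFrame _ _ h := h.isOpen
  frame_ne_zero _ _ h a ha := by
    obtain ⟨n, -, hn⟩ := h.torsion a ha
    exact hn.self_of_nhds.1
  exists_frame := g.exists_isFlatFrame S
  frame_compat U σ V τ hσ hτ a ha c hc := by
    obtain ⟨n, hn, hn'⟩ := hσ.torsion a ha.1
    obtain ⟨m, hm, hm'⟩ := hτ.torsion a ha.2
    exact eventually_eq_smul_of_isTorsion (β := fun b : S => b.1) (hτ.continuousAt ha.2)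
      (hσ.continuousAt ha.1) hm hn hm' hn' hc
  act_flat U σ V τ hσ hτ p hp1 hp2 c hc := by
    obtain ⟨n, hn, hn'⟩ := hσ.torsion _ hp1
    obtain ⟨m, hm, hm'⟩ := hτ.torsion _ hp2
    have ha : Continuous fun q : G.SectorArrow S => q.1.1 := by fun_prop
    have hb : Continuous fun q : G.SectorArrow S => q.1.2.2 := by fun_prop
    have hv : Continuous fun q : G.SectorArrow S => q.1.2.1 := by fun_prop
    have hb' : Continuous fun q : G.SectorArrow S => q.1.2.2.1.1 := by fun_prop
    have h1 : ContinuousAt (fun q : G.SectorArrow S =>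
        (⟨q.1.1.1.1, σ q.1.1⟩ : TotalSpace ℂ L)) p :=
      ContinuousAt.comp' (f := fun q : G.SectorArrow S => q.1.1) (hσ.continuousAt hp1)
        ha.continuousAt
    have h2 : ContinuousAt (fun q : G.SectorArrow S =>
        (⟨q.1.2.2.1.1, τ q.1.2.2⟩ : TotalSpace ℂ L)) p :=
      ContinuousAt.comp' (f := fun q : G.SectorArrow S => q.1.2.2) (hτ.continuousAt hp2)
        hb.continuousAt
    refine eventually_eq_smul_of_isTorsion (g := g) (β := fun q : G.SectorArrow S => q.1.2.2.1)
      (continuousAt_rho (g := g) (fun q : G.SectorArrow S => q.2) h1 hv.continuousAt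
        hb'.continuousAt) h2 hn hm ?_ (hb.continuousAt.eventually hm') hc
    filter_upwards [ha.continuousAt.eventually hn'] with q hq
    exact hq.rho q.2

end FlatFrames

end Gerbe

/-! ### Base points of multisectors -/

section UnitProducts

variable {E G₀ G₁ : Type*} [NormedAddCommGroup E] [NormedSpace ℝ E]
  [TopologicalSpace G₀] [ChartedSpace E G₀] [TopologicalSpace G₁] [ChartedSpace E G₁]
  {G : OrbifoldGroupoid E G₀ G₁} {n : ℕ}

theorem mul_congr {a a' b b' : G₁} (ha : a = a') (hb : b = b') (h : G.t a = G.s b)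
    (h' : G.t a' = G.s b') : G.mul a b h = G.mul a' b' h' := by
  subst ha hb
  rfl

/-- Multiplying by a loop does not change the target, so every partial product ends at `x`, which
forces all loops to be based there. -/
theorem HasUnitProduct.exists_base {γ : Fin n → G.Loop} (h : G.HasUnitProduct γ) :
    ∃ x, (∀ i, G.s (γ i).1 = x) ∧ ∃ p : Fin (n + 1) → G₁, p 0 = G.e x ∧
      p (Fin.last n) = G.e x ∧ ∀ i : Fin n, ∃ h : G.t (p i.castSucc) = G.s (γ i).1,
        p i.succ = G.mul (p i.castSucc) (γ i).1 h := by
  obtain ⟨x, p, h0, hlast, hp⟩ := h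
  have ht : ∀ j, G.t (p j) = x := by
    intro j
    induction j using Fin.induction with
    | zero => rw [h0, G.t_e]
    | succ i ih =>
      obtain ⟨h, hi⟩ := hp i
      rw [hi, G.t_mul, ← (γ i).2, ← h, ih]
  refine ⟨x, fun i => ?_, p, h0, hlast, hp⟩
  obtain ⟨h, -⟩ := hp i
  rw [← h, ht]

/-- The common base point of the loops of an object of a multisector. -/
def MultiSector.base {S : Set G.Loop} [NeZero n] (q : G.MultiSector S n) : G₀ :=
  G.s (q.1.1 0).1

theorem MultiSector.s_eq_base {S : Set G.Loop} [NeZero n] (q : G.MultiSector S n) (i : Fin n) :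
    G.s (q.1.1 i).1 = MultiSector.base q := by
  obtain ⟨x, hx, -⟩ := q.2.1.exists_base
  exact (hx i).trans (hx 0).symm

theorem MultiSector.continuous_base {S : Set G.Loop} [NeZero n] :
    Continuous fun q : G.MultiSector S n => MultiSector.base q := by
  have h : Continuous fun q : G.MultiSector S n => (q.1.1 0).1 := by fun_prop
  exact G.s_etale.isLocalHomeomorph.continuous.comp h

end UnitProducts

namespace Gerbe

/-! ### The product form on multisectors -/

section Forms

variable {E G₀ G₁ : Type*} [NormedAddCommGroup E] [NormedSpace ℝ E]
  [TopologicalSpace G₀] [ChartedSpace E G₀] [TopologicalSpace G₁] [ChartedSpace E G₁]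
  {G : OrbifoldGroupoid E G₀ G₁} {L : G₁ → Type*}
  [∀ a, AddCommGroup (L a)] [∀ a, Module ℂ (L a)] [∀ a, TopologicalSpace (L a)]
  [TopologicalSpace (TotalSpace ℂ L)] [FiberBundle ℂ L] [VectorBundle ℂ ℂ L]
  {g : G.Gerbe L} {S : Set G.Loop} {n : ℕ} {x y : G₀}

/-- The partial products of the `l i` lie over those of the loops `γ i`, the last of which is a
unit. -/
theorem exists_smul_one_eq_partialProd {γ : Fin n → G.Loop} (h : G.HasUnitProduct γ)
    (hx : ∀ i, G.s (γ i).1 = x) [NeZero n] (l : Fin n → g.Hom x x)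
    (hl : ∀ i, (l i).1.1 = (γ i).1) :
    ∃ c : ℂˣ, Fin.partialProd l (Fin.last n) = c • 1 := by
  obtain ⟨x', hx', p, h0, hlast, hp⟩ := h.exists_base
  obtain rfl : x = x' := (hx 0).symm.trans (hx' 0)
  have key : ∀ j, (Fin.partialProd l j).1.1 = p j := by
    intro j
    induction j using Fin.induction with
    | zero => rw [Fin.partialProd_zero, Hom.one_val_arrow, h0]
    | succ i ih =>
      obtain ⟨h, hi⟩ := hp i
      rw [Fin.partialProd_succ, hi]
      exact mul_congr ih (hl i) _ _
  exact Hom.exists_smul_one_eq _ ((key _).trans hlast)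

theorem partialProd_smul (k : Fin n → ℂˣ) (l : Fin n → g.Hom x x) (j : Fin (n + 1)) :
    Fin.partialProd (fun i => k i • l i) j = Fin.partialProd k j • Fin.partialProd l j := by
  induction j using Fin.induction with
  | zero => simp
  | succ i ih => rw [Fin.partialProd_succ, Fin.partialProd_succ, Fin.partialProd_succ, ih,
      smul_mul_smul_comm]

theorem partialProd_map {Γ Γ' : Type*} [Monoid Γ] [Monoid Γ'] (f : Γ →* Γ') (l : Fin n → Γ)
    (j : Fin (n + 1)) :
    Fin.partialProd (fun i => f (l i)) j = f (Fin.partialProd l j) := by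
  induction j using Fin.induction with
  | zero => simp
  | succ i ih => rw [Fin.partialProd_succ, Fin.partialProd_succ, ih, map_mul]

theorem partialProd_last {Γ : Type*} [CommMonoid Γ] (k : Fin n → Γ) :
    Fin.partialProd k (Fin.last n) = ∏ i, k i := by
  rw [Fin.partialProd, List.take_of_length_le (by simp), List.prod_ofFn]

/-- The transport of a nonzero vector against an arrow `a ⟶ b` of `∧G`, as an automorphism of `x`
in the central extension. -/
noncomputable def pull (g : G.Gerbe L) {a b : G.Loop} {v : G₁} (hv : G.IsInertiaArrow a v b)
    (hx : G.s a.1 = x) {u : L b.1} (hu : u ≠ 0) : g.Hom x x :=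
  (Hom.conj (Hom.exists_lift g v (hv.choose.symm.trans (a.2.symm.trans hx))
    hv.choose_spec.choose).choose).symm (Hom.ofLoop g b rfl hu)

section Pull

variable {a b : G.Loop} {v : G₁} (hv : G.IsInertiaArrow a v b) (hx : G.s a.1 = x)
  {u : L b.1} (hu : u ≠ 0)

theorem conj_pull (w : g.Hom x (G.s b.1)) (hw : w.1.1 = v) :
    Hom.conj w (g.pull hv hx hu) = Hom.ofLoop g b rfl hu := by
  have h := (Hom.exists_lift g v (hv.choose.symm.trans (a.2.symm.trans hx))
    hv.choose_spec.choose).choose_spec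
  rw [Hom.conj_congr (hw.trans h.symm), pull, MulEquiv.apply_symm_apply]

/-- The line over `b` is spanned by `ρ(u₀)` with `u₀ ≠ 0` over `a`; if `u = c • ρ(u₀)`, its
transport back is `c • u₀`. -/
theorem pull_arrow : (g.pull hv hx hu).1.1 = a.1 := by
  obtain ⟨w, hw⟩ := Hom.exists_lift g v (hv.choose.symm.trans (a.2.symm.trans hx))
    hv.choose_spec.choose
  obtain ⟨u₀, hu₀⟩ := exists_fiber_ne_zero L a.1
  obtain ⟨c, hc⟩ := exists_smul_eq_of_ne_zero (g.rho_ne_zero hv hu₀) u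
  have hc0 : c ≠ 0 := by
    rintro rfl
    exact hu (hc.symm.trans (zero_smul _ _))
  have h1 : g.pull hv hx hu = Units.mk0 c hc0 • Hom.ofLoop g a hx hu₀ := by
    apply (Hom.conj w).injective
    rw [conj_pull hv hx hu w hw, Hom.conj_smul, ← g.ofLoop_rho hv hx rfl w hw hu₀]
    subst hc
    rfl
  rw [h1]
  rfl

theorem pull_smul (c : ℂˣ) (hcu : (c : ℂ) • u ≠ 0) :
    g.pull hv hx hcu = c • g.pull hv hx hu := by
  rw [pull, Hom.ofLoop_smul b rfl hu, Hom.conj_symm_smul]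
  rfl

theorem pull_pow {m : ℕ} (h : g.IsTorsion m b u) : g.pull hv hx hu ^ m = 1 := by
  rw [pull, ← map_pow, h.2, map_one]

end Pull

/-- With `w` a lift of `v`, the equation `pull · w = w · u` exhibits the pulled-back vector as a
right quotient of continuous families. -/
theorem continuousAt_pull {X : Type*} [TopologicalSpace X] {r₀ : X} {α β : X → G.Loop}
    {v : X → G₁} {x : X → G₀} (hv : ∀ r, G.IsInertiaArrow (α r) (v r) (β r))
    (hx : ∀ r, G.s (α r).1 = x r) {u : ∀ r, L (β r).1} (hu0 : ∀ r, u r ≠ 0)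
    (hu : ContinuousAt (fun r => (⟨(β r).1, u r⟩ : TotalSpace ℂ L)) r₀)
    (hvc : ContinuousAt v r₀) (hα : ContinuousAt (fun r => (α r).1) r₀) :
    ContinuousAt (fun r => (g.pull (hv r) (hx r) (hu0 r)).1) r₀ := by
  obtain ⟨W, hW, hWc⟩ := exists_continuousAt_section L (v r₀)
  have h1 : ContinuousAt (fun r => (⟨v r, W (v r)⟩ : TotalSpace ℂ L)) r₀ :=
    ContinuousAt.comp' (f := v) hWc hvc
  have hs : ∀ r, G.s (v r) = x r := fun r =>
    (hv r).choose.symm.trans ((α r).2.symm.trans (hx r))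
  have ht : ∀ r, G.t (v r) = G.s (β r).1 := fun r => (hv r).choose_spec.choose
  refine continuousAt_of_prod_right (g := g)
    (hα.congr (Filter.Eventually.of_forall fun r => (pull_arrow (hv r) (hx r) (hu0 r)).symm)) h1
    (continuousAt_prod (g := g) h1 hu ht) (hW _)
    (fun r => (g.pull (hv r) (hx r) (hu0 r)).2.2.2.trans (hs r).symm) fun r => ?_
  let w : g.Hom (x r) (G.s (β r).1) := ⟨⟨v r, W (v r)⟩, hW _, hs r, ht r⟩
  have h2 := Hom.comp_conj w (g.pull (hv r) (hx r) (hu0 r))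
  rw [conj_pull (hv r) (hx r) (hu0 r) w rfl] at h2
  exact congrArg Subtype.val h2.symm

variable [NeZero n]

/-- The product of `n` vectors over the multisector, transported to its base point. -/
noncomputable def sectorProd (g : G.Gerbe L) (q : G.MultiSector S n)
    {u : ∀ i, L (q.1.2.2 i).1.1} (hu : ∀ i, u i ≠ 0) :
    g.Hom (MultiSector.base q) (MultiSector.base q) :=
  Fin.partialProd (fun i => g.pull (q.2.2 i) (MultiSector.s_eq_base q i) (hu i)) (Fin.last n)

theorem exists_sectorProd_eq (q : G.MultiSector S n) {u : ∀ i, L (q.1.2.2 i).1.1}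
    (hu : ∀ i, u i ≠ 0) : ∃ c : ℂˣ, g.sectorProd q hu = c • 1 :=
  exists_smul_one_eq_partialProd q.2.1 (MultiSector.s_eq_base q) _ fun _ => pull_arrow _ _ _

variable (g) in
/-- The product of `n` vectors over the multisector is an `n`-linear form. -/
theorem exists_sectorForm (q : G.MultiSector S n) :
    ∃ φ : MultilinearMap ℂ (fun i => L (q.1.2.2 i).1.1) ℂ,
      ∀ (u : ∀ i, L (q.1.2.2 i).1.1) (hu : ∀ i, u i ≠ 0) (c : ℂˣ),
        g.sectorProd q hu = c • 1 → φ u = c := by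
  choose u₀ hu₀ using fun i => exists_fiber_ne_zero L (q.1.2.2 i).1.1
  obtain ⟨c₀, hc₀⟩ := exists_sectorProd_eq (g := g) q hu₀
  let φ : ∀ i, L (q.1.2.2 i).1.1 →ₗ[ℂ] ℂ := fun i =>
    (LinearEquiv.ofBijective (LinearMap.toSpanSingleton ℂ _ (u₀ i))
      ⟨smul_left_injective ℂ (hu₀ i), fun w => exists_smul_eq_of_ne_zero (hu₀ i) w⟩).symm
  have hφ : ∀ i (k : ℂ), φ i (k • u₀ i) = k := fun i k =>
    LinearEquiv.symm_apply_apply (LinearEquiv.ofBijective (LinearMap.toSpanSingleton ℂ _ (u₀ i))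
      ⟨smul_left_injective ℂ (hu₀ i), fun w => exists_smul_eq_of_ne_zero (hu₀ i) w⟩) k
  -- Here `c₀` is the scalar of the chosen basis vectors `u₀ i`, and `φ i` is the coordinate with
  -- respect to `u₀ i`.
  refine ⟨(c₀ : ℂ) • (MultilinearMap.mkPiAlgebra ℂ (Fin n) ℂ).compLinearMap φ, fun u hu c hc => ?_⟩
  choose k hk using fun i => exists_smul_eq_of_ne_zero (hu₀ i) (u i)
  obtain rfl : (fun i => k i • u₀ i) = u := funext hk
  have hk0 : ∀ i, k i ≠ 0 := fun i h => hu i ((congrArg (· • u₀ i) h).trans (zero_smul ℂ _))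
  have h1 : g.sectorProd q hu = (∏ i, Units.mk0 (k i) (hk0 i)) • g.sectorProd q hu₀ := by
    rw [← partialProd_last, sectorProd, sectorProd, ← partialProd_smul]
    congr 1
    funext i
    exact pull_smul (q.2.2 i) (MultiSector.s_eq_base q i) (hu₀ i) (Units.mk0 (k i) (hk0 i)) (hu i)
  rw [hc, hc₀, smul_smul] at h1
  have h2 := congrArg Units.val (Hom.smul_left_cancel h1)
  simp only [smul_apply, MultilinearMap.compLinearMap_apply, hφ,
    MultilinearMap.mkPiAlgebra_apply, smul_eq_mul]
  rw [h2, mul_comm]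
  simp

/-- The multilinear form given by the product over the multisector. -/
noncomputable def sectorForm (g : G.Gerbe L) (q : G.MultiSector S n) :
    MultilinearMap ℂ (fun i => L (q.1.2.2 i).1.1) ℂ :=
  (g.exists_sectorForm q).choose

theorem sectorForm_eq (q : G.MultiSector S n) {u : ∀ i, L (q.1.2.2 i).1.1} (hu : ∀ i, u i ≠ 0)
    {c : ℂˣ} (h : g.sectorProd q hu = c • 1) : g.sectorForm q u = c :=
  (g.exists_sectorForm q).choose_spec u hu c h

theorem sectorProd_eq (q : G.MultiSector S n) {u : ∀ i, L (q.1.2.2 i).1.1} (hu : ∀ i, u i ≠ 0) :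
    ∃ c : ℂˣ, g.sectorProd q hu = c • 1 ∧ g.sectorForm q u = c := by
  obtain ⟨c, hc⟩ := exists_sectorProd_eq (g := g) q hu
  exact ⟨c, hc, sectorForm_eq q hu hc⟩

/-- The composites `p · r` and `w · p'` of lifts lie over the same arrow `v y = z v'`, so they
conjugate alike. -/
theorem pull_rho {a b a' b' : G.Loop} {v v' z y : G₁} (hv : G.IsInertiaArrow a v b)
    (hv' : G.IsInertiaArrow a' v' b') (hy : G.IsInertiaArrow b y b')
    {x x' : G₀} (hx : G.s a.1 = x) (hx' : G.s a'.1 = x') (w : g.Hom x x') (hw : w.1.1 = z)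
    (h : G.t v = G.s y) (h' : G.t z = G.s v') (heq : G.mul v y h = G.mul z v' h')
    {u : L b.1} (hu : u ≠ 0) :
    g.pull hv' hx' (g.rho_ne_zero hy hu) = Hom.conj w (g.pull hv hx hu) := by
  obtain ⟨p, hp⟩ := Hom.exists_lift g v (hv.choose.symm.trans (a.2.symm.trans hx))
    hv.choose_spec.choose
  obtain ⟨p', hp'⟩ := Hom.exists_lift g v' (hv'.choose.symm.trans (a'.2.symm.trans hx'))
    hv'.choose_spec.choose
  obtain ⟨r, hr⟩ := Hom.exists_lift g y (hy.choose.symm.trans b.2.symm) hy.choose_spec.choose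
  apply (Hom.conj p').injective
  have hpr : (w.comp p').1.1 = (p.comp r).1.1 :=
    (mul_congr hw hp' _ h').trans (heq.symm.trans (mul_congr hp.symm hr.symm h _))
  rw [conj_pull hv' hx' _ p' hp', ← Hom.conj_comp, Hom.conj_congr hpr, Hom.conj_comp,
    conj_pull hv hx hu p hp, g.ofLoop_rho hy rfl rfl r hr hu]

theorem sectorForm_invariant (q q' : G.MultiSector S n) (z : G₁) (y : Fin n → G₁)
    (h : G.IsMultiSectorArrow q q' z y) (u : ∀ i, L (q.1.2.2 i).1.1) :
    g.sectorForm q' (fun i => g.rho (q.1.2.2 i).1 (q'.1.2.2 i).1 (y i) (h i).2.1 (u i)) =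
      g.sectorForm q u := by
  by_cases hu : ∀ i, u i ≠ 0
  · obtain ⟨c, hc, hcq⟩ := sectorProd_eq (g := g) q hu
    rw [hcq]
    refine sectorForm_eq q' (fun i => g.rho_ne_zero (h i).2.1 (hu i)) ?_
    obtain ⟨w, hw⟩ := Hom.exists_lift g (x := MultiSector.base q) (y := MultiSector.base q') z
      ((h 0).1.choose.symm.trans (q.1.1 0).2.symm) ((h 0).1.choose_spec.choose)
    have key : g.sectorProd q' (fun i => g.rho_ne_zero (h i).2.1 (hu i)) =
        Hom.conj w (g.sectorProd q hu) := by
      rw [sectorProd, sectorProd]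
      refine Eq.trans ?_ (partialProd_map (Hom.conj w).toMonoidHom _ _)
      congr 1
      funext i
      obtain ⟨-, h2, k, k', hk⟩ := h i
      exact pull_rho (q.2.2 i) (q'.2.2 i) h2 _ _ w hw k k' hk (hu i)
    rw [key, hc, Hom.conj_smul, map_one]
  -- A zero vector has no place in the extension, but then both forms vanish by multilinearity.
  · push Not at hu
    obtain ⟨i, hi⟩ := hu
    rw [MultilinearMap.map_coord_zero _ i hi, MultilinearMap.map_coord_zero _ i]
    rw [hi, map_zero]

theorem continuousAt_sectorProd {q : G.MultiSector S n} {σ : Fin n → ∀ a : S, L a.1.1}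
    (hσ0 : ∀ i a, σ i a ≠ 0)
    (hσ : ∀ i, ContinuousAt (fun a : S => (⟨a.1.1, σ i a⟩ : TotalSpace ℂ L)) (q.1.2.2 i)) :
    ContinuousAt (fun r : G.MultiSector S n =>
      (g.sectorProd r fun i => hσ0 i (r.1.2.2 i)).1) q := by
  have hpull : ∀ i, ContinuousAt (fun r : G.MultiSector S n =>
      (g.pull (r.2.2 i) (MultiSector.s_eq_base r i) (hσ0 i (r.1.2.2 i))).1) q := by
    intro i
    have hb : Continuous fun r : G.MultiSector S n => r.1.2.2 i := by fun_prop
    have hv : Continuous fun r : G.MultiSector S n => r.1.2.1 i := by fun_prop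
    have ha : Continuous fun r : G.MultiSector S n => (r.1.1 i).1 := by fun_prop
    exact continuousAt_pull (g := g) (fun r : G.MultiSector S n => r.2.2 i) _ _
      (ContinuousAt.comp' (f := fun r : G.MultiSector S n => r.1.2.2 i) (hσ i) hb.continuousAt)
      hv.continuousAt ha.continuousAt
  have key : ∀ j, ContinuousAt (fun r : G.MultiSector S n =>
      (Fin.partialProd (fun i => g.pull (r.2.2 i) (MultiSector.s_eq_base r i)
        (hσ0 i (r.1.2.2 i))) j).1) q := by
    intro j
    induction j using Fin.induction with
    | zero =>
      simp only [Fin.partialProd_zero]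
      exact continuousAt_one (MultiSector.continuous_base.continuousAt)
    | succ i ih =>
      simp only [Fin.partialProd_succ]
      exact continuousAt_prod (g := g) ih (hpull i) _
  exact key (Fin.last n)

end Forms

/-! ### Flatness of the product form -/

section LocalSystem

variable {E G₀ G₁ : Type*} [NormedAddCommGroup E] [NormedSpace ℝ E]
  [TopologicalSpace G₀] [ChartedSpace E G₀] [TopologicalSpace G₁] [ChartedSpace E G₁]
  {G : OrbifoldGroupoid E G₀ G₁} {L : G₁ → Type*}
  [∀ a, AddCommGroup (L a)] [∀ a, Module ℂ (L a)] [∀ a, TopologicalSpace (L a)]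
  [TopologicalSpace (TotalSpace ℂ L)] [FiberBundle ℂ L] [VectorBundle ℂ ℂ L]
  {g : G.Gerbe L} {S : Set G.Loop} {n : ℕ} [NeZero n]

/-- The scalar of the product is continuous, being the ratio of the product to the unit section, and
it is a root of unity of bounded order because the factors are torsion; hence it is locally
constant. -/
theorem sectorForm_flat_of_ne_zero {q : G.MultiSector S n} {σ : Fin n → ∀ a : S, L a.1.1}
    (hσ0 : ∀ i a, σ i a ≠ 0)
    (hσ : ∀ i, ContinuousAt (fun a : S => (⟨a.1.1, σ i a⟩ : TotalSpace ℂ L)) (q.1.2.2 i))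
    {m : ℕ} (hm : 0 < m) (htor : ∀ i, ∀ᶠ a in 𝓝 (q.1.2.2 i), g.IsTorsion m a.1 (σ i a)) :
    ∀ᶠ r : G.MultiSector S n in 𝓝 q, g.sectorForm r (fun i => σ i (r.1.2.2 i)) =
      g.sectorForm q (fun i => σ i (q.1.2.2 i)) := by
  choose c hc hcf using fun r : G.MultiSector S n =>
    sectorProd_eq (g := g) r fun i => hσ0 i (r.1.2.2 i)
  have hbase : ContinuousAt (fun r : G.MultiSector S n => MultiSector.base r) q :=
    MultiSector.continuous_base.continuousAt
  have hcont : ContinuousAt (fun r => (c r : ℂ)) q := by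
    refine continuousAt_ratio (continuousAt_sectorProd (g := g) hσ0 hσ)
      (continuousAt_one (g := g) hbase) (1 : g.Hom (MultiSector.base q) (MultiSector.base q)).2.1
      (Filter.Eventually.of_forall fun r => ?_)
    rw [hc r]
    rfl
  obtain ⟨N, hN, hpow⟩ := g.exists_pow_partialProd_eq_one (MultiSector.base q)
  have htor' : ∀ᶠ r : G.MultiSector S n in 𝓝 q,
      ∀ i, g.IsTorsion m (r.1.2.2 i).1 (σ i (r.1.2.2 i)) := by
    rw [Filter.eventually_all]
    intro i
    have hb : Continuous fun r : G.MultiSector S n => r.1.2.2 i := by fun_prop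
    exact hb.continuousAt.eventually (htor i)
  have hroot : ∀ᶠ r : G.MultiSector S n in 𝓝 q, (c r : ℂ) ^ (N * m) = 1 := by
    filter_upwards [hbase.eventually hpow, htor'] with r h1 h2
    have h3 := h1 m n _ (fun i => pull_pow (r.2.2 i) (MultiSector.s_eq_base r i)
      (hσ0 i (r.1.2.2 i)) (h2 i)) (Fin.last n)
    have h4 : (c r • (1 : g.Hom (MultiSector.base r) (MultiSector.base r))) ^ (N * m) = 1 := by
      rw [← hc r]
      exact h3
    rw [smul_pow, one_pow] at h4
    have h5 := Hom.smul_left_cancel (h4.trans (one_smul ℂˣ _).symm)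
    simpa using congrArg Units.val h5
  filter_upwards [eventually_eq_of_pow_eq_one hcont (Nat.mul_pos hN hm) hroot] with r hr
  rw [hcf, hcf, hr]

/-- The product form is locally constant in flat frames. -/
theorem sectorForm_flat {U : Fin n → Set S} {σ : Fin n → ∀ a : S, L a.1.1}
    (hσ : ∀ i, g.IsFlatFrame S (U i) (σ i)) {q : G.MultiSector S n}
    (hq : ∀ i, q.1.2.2 i ∈ U i) :
    ∀ᶠ r : G.MultiSector S n in 𝓝 q, g.sectorForm r (fun i => σ i (r.1.2.2 i)) =
      g.sectorForm q (fun i => σ i (q.1.2.2 i)) := by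
  choose m hm htor using fun i => (hσ i).torsion _ (hq i)
  -- A flat frame may vanish outside `U i`, whereas the product needs nonzero vectors everywhere;
  -- only the values near `q` matter.
  have hex : ∀ i (a : S), ∃ u : L a.1.1, u ≠ 0 ∧ (σ i a ≠ 0 → u = σ i a) := by
    intro i a
    by_cases h : σ i a = 0
    · obtain ⟨u, hu⟩ := exists_fiber_ne_zero L a.1.1
      exact ⟨u, hu, fun h' => absurd h h'⟩
    · exact ⟨σ i a, h, fun _ => rfl⟩
  choose τ hτ0 hτ using hex
  have heq : ∀ i, ∀ᶠ a in 𝓝 (q.1.2.2 i), τ i a = σ i a := by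
    intro i
    filter_upwards [htor i] with a ha
    exact hτ i a ha.1
  -- The product of the orders `m i` is a common torsion exponent for all frames.
  have hflat := sectorForm_flat_of_ne_zero (g := g) (q := q) (m := ∏ i, m i) hτ0
    (fun i => ((hσ i).continuousAt (hq i)).congr (by
      filter_upwards [heq i] with a ha
      rw [ha]))
    (Finset.prod_pos fun i _ => hm i) (fun i => by
      filter_upwards [heq i, htor i] with a ha ⟨h0, h1⟩
      rw [ha]
      obtain ⟨k, hk⟩ := Finset.dvd_prod_of_mem m (Finset.mem_univ i)
      exact ⟨h0, by rw [hk, pow_mul, h1, one_pow]⟩)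
  have heq' : ∀ᶠ r : G.MultiSector S n in 𝓝 q, ∀ i, τ i (r.1.2.2 i) = σ i (r.1.2.2 i) := by
    rw [Filter.eventually_all]
    intro i
    have hb : Continuous fun r : G.MultiSector S n => r.1.2.2 i := by fun_prop
    exact hb.continuousAt.eventually (heq i)
  filter_upwards [hflat, heq'] with r h1 h2
  rw [← funext h2, ← funext heq'.self_of_nhds, h1]

variable [VectorBundle ℝ ℂ L] [ContMDiffVectorBundle ∞ ℂ L 𝓘(ℝ, E)]

variable (g S n) in
/-- The gerbe product trivializes the flat line orbibundle over the multisectors. -/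
noncomputable def flatTrivialization : FlatTrivialization (g.flatLineOrbibundle S) n where
  form := g.sectorForm
  form_ne_zero q u hu := by
    obtain ⟨c, -, hc⟩ := sectorProd_eq (g := g) q hu
    exact hc ▸ c.ne_zero
  form_invariant := sectorForm_invariant
  form_flat _ _ hσ _ hq := sectorForm_flat hσ hq

end LocalSystem

end Gerbe

end OrbifoldGroupoid

theorem mainTheorem5 {E G₀ G₁ : Type*}
    [NormedAddCommGroup E] [NormedSpace ℝ E] [FiniteDimensional ℝ E]
    [TopologicalSpace G₀] [T2Space G₀] [ChartedSpace E G₀] [IsManifold 𝓘(ℝ, E) ∞ G₀]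
    [TopologicalSpace G₁] [T2Space G₁] [ChartedSpace E G₁] [IsManifold 𝓘(ℝ, E) ∞ G₁]
    (G : OrbifoldGroupoid E G₀ G₁)
    (L : G₁ → Type*)
    [∀ a, AddCommGroup (L a)] [∀ a, Module ℂ (L a)] [∀ a, TopologicalSpace (L a)]
    [TopologicalSpace (TotalSpace ℂ L)] [FiberBundle ℂ L] [VectorBundle ℂ ℂ L]
    [VectorBundle ℝ ℂ L] [ContMDiffVectorBundle ∞ ℂ L 𝓘(ℝ, E)]
    (g : G.Gerbe L) (S : Set G.Loop) (hS : G.IsTwistedSectors S) :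
    ∃ B : G.InnerLocalSystem S (fun a => L a.1.1),
      (∀ (a b : S) (v : G₁) (hv : G.IsInertiaArrow a.1 v b.1),
        B.act a b v hv = g.rho a.1 b.1 v hv) ∧
      ∀ (U : Set S) (σ : ∀ a : S, L a.1.1), B.IsFrame U σ → ∀ a ∈ U,
        ∃ (W : Set G₁) (τ : ∀ x : G₁, L x), IsOpen W ∧ a.1.1 ∈ W ∧
          ContMDiffOn 𝓘(ℝ, E) (𝓘(ℝ, E).prod 𝓘(ℝ, ℂ)) ∞
            (fun x => TotalSpace.mk' ℂ x (τ x)) W ∧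
          ∀ b ∈ U, b.1.1 ∈ W → σ b = τ b.1.1 := by
  -- The three conditions are the cases of one, two and three loops of the same product form.
  exact ⟨{ g.flatLineOrbibundle S with
      nontwisted := g.flatTrivialization S 1
      inversion := g.flatTrivialization S 2
      triple := g.flatTrivialization S 3 },
    fun _ _ _ _ => rfl, fun _ _ h => h.smooth⟩
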